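/- Let $d\in\mathbb N$, $k\ge 2$, and let $\mathbf T^d=\mathbb R^d/\mathbb Z^d$ be the flat torus with the uniform probability measure $dx$. Let $F_{in},F_{out}:\mathbf T^d\to[0,1]$ be measurable and even, i.e. $F_{in}(-x)=F_{in}(x)$ and $F_{out}(-x)=F_{out}(x)$ for all $x$ (in particular, functions of the distance $\|x\|$ to $0$ are allowed), and write $\hat\varphi(z)=\int_{\mathbf T^d}\varphi(x)e^{-2\pi i\langle z,x\rangle}\,dx$ for $z\in\mathbb Z^d$; by evenness $\hat F_{in}(z)$ and $\hat F_{out}(z)$ are real. Assume that $F_{in}(0)$ and $F_{out}(0)$ are equal to the values at $0$ of the Fourier series of $F_{in}$ and $F_{out}$: for some sequence of finite sets $S_M\subset\mathbb Z^d$ such that every finite subset of $\mathbb Z^d$ is contained in $S_M$ for all large $M$ (for instance, the cubes $\{\|z\|_\infty\le M\}$), $\sum_{z\in S_M}\hat F_{in}(z)\to F_{in}(0)$ and $\sum_{z\in S_M}\hat F_{out}(z)\to F_{out}(0)$ as $M\to\infty$. For every $n$ divisible by $k$ let $\sigma^{(n)}:[n]\to[k]$ be an assignment of the $n$ vertices to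 $k$ communities of size $n/k$ each, and let $G_n$ be a random graph of the soft geometric block model (SGBM): the positions $X_1,\dots,X_n$ are independent and uniform on $\mathbf T^d$ and, given $X_1,\dots,X_n$, the pairs $i<j$ are joined independently, with probability $F_{in}(X_i-X_j)$ if $\sigma^{(n)}_i=\sigma^{(n)}_j$ and $F_{out}(X_i-X_j)$ otherwise. The graphs $G_n$ (with their positions) for different $n$ are defined on one probability space, with an arbitrary joint distribution. Let $\lambda_1\ge\dots\ge\lambda_n$ be the eigenvalues of the adjacency matrix of $G_n$ and let $$\mu_n=\sum_{j=1}^n\delta_{\lambda_j/n},\qquad \mu=\sum_{z\in\mathbb Z^d}\Big[\delta_{(\hat F_{in}(z)+(k-1)\hat F_{out}(z))/k}+(k-1)\,\delta_{(\hat F_{in}(z)-\hat F_{out}(z))/k}\Big].$$ Then, almost surely, $$\lim_{n\to\infty,\ k\mid n}\mu_n(\mathcal B)=\mu(\mathcal B)\quad\text{for every Borel set }\mathcal B\subset\mathbb R\text{ with }\mu(\partial\mathcal B)=0\text{ and }0\notin\overline{\mathcal B}.$$ -/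

import Mathlib

open MeasureTheory ProbabilityTheory Filter Topology
open scoped ENNReal

noncomputable section

namespace SGBM

/-- The uniform (normalized Haar, i.e. Lebesgue) probability measure on the flat unit torus
`ℝ^d / ℤ^d`. -/
def torusMeasure (d : ℕ) : Measure (UnitAddTorus (Fin d)) :=
  Measure.pi fun _ => AddCircle.haarAddCircle

/-- The homogeneous connection function on `k` communities: `Fᵢₙ` inside a community, `Fₒᵤₜ`
between two different communities. -/
def blockFun {d k : ℕ} (Fᵢₙ Fₒᵤₜ : UnitAddTorus (Fin d) → ℝ) :
    UnitAddTorus (Fin d) → Fin k → Fin k → ℝ :=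
  fun x a b => if a = b then Fᵢₙ x else Fₒᵤₜ x

open scoped Classical in
/-- The probability of the graph `H` given the community labels `σ` and the positions `x`:
pairs `i < j` are joined independently, with probability `F (x i - x j) (σ i) (σ j)`. -/
def graphProb {d k n : ℕ} (F : UnitAddTorus (Fin d) → Fin k → Fin k → ℝ) (σ : Fin n → Fin k)
    (x : Fin n → UnitAddTorus (Fin d)) (H : SimpleGraph (Fin n)) : ℝ :=
  ∏ i : Fin n, ∏ j ∈ Finset.Ioi i,
    if H.Adj i j then F (x i - x j) (σ i) (σ j) else 1 - F (x i - x j) (σ i) (σ j)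

/-- The random positions `X` and the random graph `G` follow the soft geometric block model with
connection function `F` and labels `σ`: the positions are independent and uniform on the torus,
and given `X` the graph has law `graphProb F σ X`. -/
structure IsSGBM {Ω : Type*} [MeasurableSpace Ω] (P : Measure Ω) {d k n : ℕ}
    (F : UnitAddTorus (Fin d) → Fin k → Fin k → ℝ) (σ : Fin n → Fin k)
    (X : Fin n → Ω → UnitAddTorus (Fin d)) (G : Ω → SimpleGraph (Fin n)) : Prop where
  measurable_position : ∀ i, Measurable (X i)
  measurable_graph : Measurable G
  indep_position : iIndepFun X P
  uniform_position : ∀ i, P.map (X i) = torusMeasure d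
  graph_law : ∀ (H : SimpleGraph (Fin n)) (S : Set (Fin n → UnitAddTorus (Fin d))),
    MeasurableSet S →
      P {ω | (fun i => X i ω) ∈ S ∧ G ω = H} =
        ∫⁻ ω in {ω | (fun i => X i ω) ∈ S},
          ENNReal.ofReal (graphProb F σ (fun i => X i ω) H) ∂P

open scoped Classical in
/-- The measure `∑ j, δ_{λ_j / n}`, where the `λ_j` are the eigenvalues (with multiplicity) of
the adjacency matrix of the graph `H` on `n` vertices. -/
def spectralMeasure {n : ℕ} (H : SimpleGraph (Fin n)) : Measure ℝ :=
  ∑ j : Fin n, Measure.dirac ((H.isHermitian_adjMatrix ℝ).eigenvalues j / n)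

/-- The Fourier coefficient `∫ φ(x) e^{-2πi⟨z,x⟩} dx` of a real function on the torus. -/
def fourierCoef {d : ℕ} (φ : UnitAddTorus (Fin d) → ℝ) (z : Fin d → ℤ) : ℂ :=
  ∫ x, UnitAddTorus.mFourier (-z) x * (φ x : ℂ) ∂(torusMeasure d)

/-- The Fourier series of `φ`, summed along the finite sets `S 0, S 1, …` of frequencies,
converges to `φ 0` at the point `0`. -/
def EqFourierSeriesAtZero {d : ℕ} (S : ℕ → Finset (Fin d → ℤ))
    (φ : UnitAddTorus (Fin d) → ℝ) : Prop :=
  Tendsto (fun N => ∑ z ∈ S N, fourierCoef φ z * UnitAddTorus.mFourier z 0) atTop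
    (𝓝 (φ 0 : ℂ))

/-- The measure `∑_z (δ_{(F̂in z + (k-1) F̂out z)/k} + (k-1) δ_{(F̂in z - F̂out z)/k})`.
It is used for even functions, whose Fourier coefficients are real numbers, so that the real
parts below are the coefficients themselves. -/
def limitMeasure {d : ℕ} (k : ℕ) (Fᵢₙ Fₒᵤₜ : UnitAddTorus (Fin d) → ℝ) : Measure ℝ :=
  Measure.sum fun z : Fin d → ℤ =>
    Measure.dirac (((fourierCoef Fᵢₙ z).re + ((k : ℝ) - 1) * (fourierCoef Fₒᵤₜ z).re) / k) +
      ((k - 1 : ℕ) : ℝ≥0∞) •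
        Measure.dirac (((fourierCoef Fᵢₙ z).re - (fourierCoef Fₒᵤₜ z).re) / k)

/-- The Fourier coefficients of an even real function are real. -/
theorem fourierCoef_im {d : ℕ} {φ : UnitAddTorus (Fin d) → ℝ} (h : ∀ x, φ (-x) = φ x)
    (z : Fin d → ℤ) : (fourierCoef φ z).im = 0 := by
  have key : (starRingEnd ℂ) (fourierCoef φ z) = fourierCoef φ z := by
    unfold fourierCoef
    rw [← integral_conj]
    have h1 : ∀ x : UnitAddTorus (Fin d),
        (starRingEnd ℂ) (UnitAddTorus.mFourier (-z) x * (φ x : ℂ)) =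
          UnitAddTorus.mFourier (-z) (-x) * (φ (-x) : ℂ) := by
      intro x
      rw [map_mul, Complex.conj_ofReal, h x, ← UnitAddTorus.mFourier_neg, neg_neg]
      congr 1
      simp [UnitAddTorus.mFourier]
    simp_rw [h1]
    have : (torusMeasure d).IsNegInvariant := by
      have : (AddCircle.haarAddCircle : Measure UnitAddCircle).IsNegInvariant :=
        Measure.IsAddHaarMeasure.isNegInvariant_of_innerRegular _
      unfold torusMeasure; infer_instance
    exact integral_neg_eq_self
      (fun x => UnitAddTorus.mFourier (-z) x * (φ x : ℂ)) (torusMeasure d)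
  exact Complex.conj_eq_iff_im.mp key

end SGBM

end

/-! The method of moments, away from the origin. The moments of the spectral measure are traces of
powers of the adjacency matrix divided by `n`, and that matrix is replaced twice by a simpler one.

First, given the positions, the adjacency matrix is close to the matrix of connection probabilities
in cut norm: a Chernoff bound for one pair of sign vectors beats the `4 ^ n` pairs, and
Borel-Cantelli makes this almost sure for any joint law of the graphs. Traces of powers of order at
least 3 are stable in this norm (`BilinLE.abs_trace_pow_sub_le`). Order 2 is not: it sees the edge
density instead of the mean square of the probabilities. This is the mass of small eigenvalues that
`0 ∉ closure B` discards.

Secondly, the connection functions are replaced by partial Fourier sums. The Hilbert-Schmidt error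
is a double sum over differences of positions, and a law of large numbers (`ae_tendsto_sum_diff`)
identifies its limit, which Parseval makes small. Traces of powers are stable in this norm as well
(`norm_trace_pow_sub_le`).

A trigonometric block matrix factors as `V C V*`, where `C` has fixed size and `V` consists of
characters at the positions. Cyclicity of the trace leaves powers of `C V*V / n`, and
equidistribution gives `V*V / n → 1 / k`. The eigenvalues of `C / k` are the atoms of the limit
measure with frequencies in the chosen set (`tendsto_trace_trigMatrix_pow`).

Finally, the moments of order at least 4 determine the limit off the origin: `x ^ 4` is a
nonnegative weight, polynomials are dense on `[-1, 1]`, and the portmanteau theorem applies to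
measures with a density equal to 1 on `B`. -/

noncomputable section

namespace SGBM

/-! ### Law of large numbers for double sums over differences of positions -/

section UStatistic

variable {T : Type*} [AddCommGroup T] [MeasurableSpace T] [MeasurableAdd₂ T]
  {μ : Measure T} [IsProbabilityMeasure μ] [μ.IsAddLeftInvariant]
  {ι : Type*} [Fintype ι] [DecidableEq ι]

/-- A bounded function on a power of a group that averages to zero along one coordinate has
integral zero. -/
theorem integral_pi_eq_zero_of_shift {φ : (ι → T) → ℝ} (hφ : Measurable φ) {C : ℝ}
    (hC : ∀ x, |φ x| ≤ C) (a : ι) (h0 : ∀ x, ∫ t, φ (x + (Pi.single a t : ι → T)) ∂μ = 0) :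
    ∫ x, φ x ∂(Measure.pi fun _ : ι => μ) = 0 := by
  have hm : Measurable fun p : T × (ι → T) => φ (p.2 + Pi.single a p.1) := by
    refine hφ.comp (measurable_pi_lambda _ fun i => ?_)
    by_cases hi : i = a
    · subst hi
      simp only [Pi.add_apply, Pi.single_eq_same]
      exact ((measurable_pi_apply i).comp measurable_snd).add measurable_fst
    · simp only [Pi.add_apply, Pi.single_eq_of_ne hi, add_zero]
      exact (measurable_pi_apply i).comp measurable_snd
  have hint : Integrable (Function.uncurry fun (t : T) (x : ι → T) => φ (x + Pi.single a t))
      (μ.prod (Measure.pi fun _ : ι => μ)) :=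
    Integrable.of_bound hm.aestronglyMeasurable C (Eventually.of_forall fun p => hC _)
  calc ∫ x, φ x ∂(Measure.pi fun _ : ι => μ)
      = ∫ _t, (∫ x, φ x ∂(Measure.pi fun _ : ι => μ)) ∂μ := by simp
    -- The product measure is translation invariant, so each shift `t` gives the same integral;
    -- after Fubini the inner average vanishes.
    _ = ∫ t, (∫ x, φ (x + Pi.single a t) ∂(Measure.pi fun _ : ι => μ)) ∂μ := by
        congr 1; ext t
        exact (integral_add_right_eq_self φ (Pi.single a t)).symm
    _ = ∫ x, (∫ t, φ (x + Pi.single a t) ∂μ) ∂(Measure.pi fun _ : ι => μ) :=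
        integral_integral_swap hint
    _ = 0 := by simp [h0]

variable [MeasurableSub₂ T] [MeasurableNeg T] [μ.IsNegInvariant] {h : T → ℝ} {C : ℝ}

/-- Two differences `x i - x j` and `x p - x q` are uncorrelated if the second does not
involve both `i` and `j`. -/
theorem integral_mul_diff_eq_zero (hm : Measurable h) (hC : ∀ x, |h x| ≤ C)
    (h0 : ∫ x, h x ∂μ = 0) {i j p q : ι} (hij : i ≠ j)
    (hpq : (i ≠ p ∧ i ≠ q) ∨ (j ≠ p ∧ j ≠ q)) :
    ∫ x, h (x i - x j) * h (x p - x q) ∂(Measure.pi fun _ : ι => μ) = 0 := by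
  have hmeas : Measurable fun x : ι → T => h (x i - x j) * h (x p - x q) := by
    refine (hm.comp ?_).mul (hm.comp ?_)
    · exact (measurable_pi_apply i).sub (measurable_pi_apply j)
    · exact (measurable_pi_apply p).sub (measurable_pi_apply q)
  have hb : ∀ x : ι → T, |h (x i - x j) * h (x p - x q)| ≤ C * C := fun x => by
    rw [abs_mul]
    exact mul_le_mul (hC _) (hC _) (abs_nonneg _) ((abs_nonneg _).trans (hC 0))
  -- Shifting the index that the second factor does not contain moves the first factor over the
  -- whole group and leaves the second fixed.
  rcases hpq with ⟨hp, hq⟩ | ⟨hp, hq⟩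
  · refine integral_pi_eq_zero_of_shift hmeas hb i fun x => ?_
    simp only [Pi.add_apply, Pi.single_eq_same, Pi.single_eq_of_ne hij.symm,
      Pi.single_eq_of_ne hp.symm, Pi.single_eq_of_ne hq.symm, add_zero]
    rw [integral_mul_const]
    have : ∫ t, h (x i + t - x j) ∂μ = ∫ t, h t ∂μ := by
      rw [← integral_add_left_eq_self h (x i - x j)]
      congr 1; ext t; congr 1; abel
    rw [this, h0, zero_mul]
  · refine integral_pi_eq_zero_of_shift hmeas hb j fun x => ?_
    simp only [Pi.add_apply, Pi.single_eq_same, Pi.single_eq_of_ne hij,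
      Pi.single_eq_of_ne hp.symm, Pi.single_eq_of_ne hq.symm, add_zero]
    rw [integral_mul_const]
    have : ∫ t, h (x i - (x j + t)) ∂μ = ∫ t, h t ∂μ := by
      rw [← integral_sub_left_eq_self h μ (x i - x j)]
      congr 1; ext t; congr 1; abel
    rw [this, h0, zero_mul]

/-- The second moment of a weighted sum of a centred function of the differences. -/
theorem integral_sq_sum_diff_le (hm : Measurable h) (hC : ∀ x, |h x| ≤ C)
    (h0 : ∫ x, h x ∂μ = 0) (w : ι × ι → ℝ) (hw : ∀ p, |w p| ≤ 1) :
    ∫ x, (∑ p ∈ (Finset.univ : Finset ι).offDiag, w p * h (x p.1 - x p.2)) ^ 2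
      ∂(Measure.pi fun _ : ι => μ) ≤ 2 * C ^ 2 * (Fintype.card ι : ℝ) ^ 2 := by
  have hC0 : 0 ≤ C := (abs_nonneg _).trans (hC 0)
  have hmeas : ∀ p : ι × ι, Measurable fun x : ι → T => h (x p.1 - x p.2) := fun p =>
    hm.comp ((measurable_pi_apply p.1).sub (measurable_pi_apply p.2))
  have hb : ∀ (p q : ι × ι) (x : ι → T), |h (x p.1 - x p.2) * h (x q.1 - x q.2)| ≤ C ^ 2 :=
    fun p q x => by
      rw [abs_mul, sq]
      exact mul_le_mul (hC _) (hC _) (abs_nonneg _) hC0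
  have hi : ∀ p q : ι × ι, Integrable (fun x : ι → T => h (x p.1 - x p.2) * h (x q.1 - x q.2))
      (Measure.pi fun _ : ι => μ) := fun p q =>
    Integrable.of_bound ((hmeas p).mul (hmeas q)).aestronglyMeasurable _
      (Eventually.of_forall (hb p q))
  have hle : ∀ p q : ι × ι, |∫ x, h (x p.1 - x p.2) * h (x q.1 - x q.2)
      ∂(Measure.pi fun _ : ι => μ)| ≤ C ^ 2 := fun p q => by
    have := norm_integral_le_of_norm_le_const (μ := Measure.pi fun _ : ι => μ)
      (f := fun x => h (x p.1 - x p.2) * h (x q.1 - x q.2)) (Eventually.of_forall (hb p q))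
    simpa using this
  have hexp : ∀ x : ι → T,
      (∑ p ∈ (Finset.univ : Finset ι).offDiag, w p * h (x p.1 - x p.2)) ^ 2 =
      ∑ p ∈ (Finset.univ : Finset ι).offDiag, ∑ q ∈ (Finset.univ : Finset ι).offDiag,
        w p * w q * (h (x p.1 - x p.2) * h (x q.1 - x q.2)) := fun x => by
    rw [sq, Finset.sum_mul_sum]
    exact Finset.sum_congr rfl fun p _ => Finset.sum_congr rfl fun q _ => by ring
  simp_rw [hexp]
  rw [integral_finsetSum _ fun p _ => integrable_finsetSum _ fun q _ => (hi p q).const_mul _]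
  have key : ∀ p ∈ (Finset.univ : Finset ι).offDiag,
      ∫ x, ∑ q ∈ (Finset.univ : Finset ι).offDiag,
        w p * w q * (h (x p.1 - x p.2) * h (x q.1 - x q.2)) ∂(Measure.pi fun _ : ι => μ)
      ≤ 2 * C ^ 2 := by
    intro p hp
    have hp' : p.1 ≠ p.2 := by simpa using hp
    rw [integral_finsetSum _ fun q _ => (hi p q).const_mul _]
    -- Only `q = p` and `q = p.swap` can be correlated with `p`, whence the factor 2.
    calc ∑ q ∈ (Finset.univ : Finset ι).offDiag, ∫ x,
        w p * w q * (h (x p.1 - x p.2) * h (x q.1 - x q.2)) ∂(Measure.pi fun _ : ι => μ)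
        ≤ ∑ q ∈ (Finset.univ : Finset ι).offDiag,
            if q ∈ ({p, p.swap} : Finset (ι × ι)) then C ^ 2 else 0 := by
          refine Finset.sum_le_sum fun q hq => ?_
          have hq' : q.1 ≠ q.2 := by simpa using hq
          rw [integral_const_mul]
          split_ifs with hmem
          · refine (le_abs_self _).trans ?_
            rw [abs_mul, abs_mul]
            calc |w p| * |w q| * _ ≤ 1 * 1 * C ^ 2 := by
                  gcongr
                  · exact hw p
                  · exact hw q
                  · exact hle p q
              _ = C ^ 2 := by ring
          · rw [integral_mul_diff_eq_zero hm hC h0 hp', mul_zero]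
            by_contra hcon
            apply hmem
            simp only [Finset.mem_insert, Finset.mem_singleton, Prod.ext_iff, Prod.fst_swap,
              Prod.snd_swap]
            grind
      _ ≤ ∑ q ∈ ({p, p.swap} : Finset (ι × ι)), C ^ 2 := by
          rw [← Finset.sum_filter]
          refine Finset.sum_le_sum_of_subset_of_nonneg (fun q hq => ?_) fun _ _ _ => sq_nonneg C
          exact (Finset.mem_filter.1 hq).2
      _ ≤ 2 * C ^ 2 := by
          rw [Finset.sum_const, nsmul_eq_mul]
          gcongr
          exact_mod_cast Finset.card_le_two
  refine (Finset.sum_le_card_nsmul _ _ _ key).trans ?_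
  rw [nsmul_eq_mul, mul_comm]
  gcongr
  rw [Finset.offDiag_card, Finset.card_univ, sq]
  exact_mod_cast Nat.sub_le _ _

/-- A strong law of large numbers, along any triangular array, for weighted double sums of a
bounded centred function of the differences of independent uniform positions. -/
theorem ae_tendsto_sum_diff {Ω : Type*} [MeasurableSpace Ω] {P : Measure Ω}
    [IsProbabilityMeasure P] {k : ℕ} (hk : 0 < k) {X : ∀ N : ℕ, Fin (k * N) → Ω → T}
    (hX : ∀ N i, Measurable (X N i))
    (hlaw : ∀ N, P.map (fun ω i => X N i ω) = Measure.pi fun _ => μ)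
    (hm : Measurable h) (hC : ∀ x, |h x| ≤ C) (h0 : ∫ x, h x ∂μ = 0)
    (w : ∀ N : ℕ, Fin (k * N) × Fin (k * N) → ℝ) (hw : ∀ N p, |w N p| ≤ 1) :
    ∀ᵐ ω ∂P, Tendsto (fun N : ℕ => (∑ p ∈ (Finset.univ : Finset (Fin (k * N))).offDiag,
      w N p * h (X N p.1 ω - X N p.2 ω)) / ((k * N : ℕ) : ℝ) ^ 2) atTop (𝓝 0) := by
  have hC0 : 0 ≤ C := (abs_nonneg _).trans (hC 0)
  let Z : ∀ N : ℕ, (Fin (k * N) → T) → ℝ := fun N x =>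
    ∑ p ∈ (Finset.univ : Finset (Fin (k * N))).offDiag, w N p * h (x p.1 - x p.2)
  have hZm : ∀ N, Measurable (Z N) := fun N => Finset.measurable_sum _ fun p _ =>
    (hm.comp ((measurable_pi_apply p.1).sub (measurable_pi_apply p.2))).const_mul _
  have hXm : ∀ N, Measurable fun ω i => X N i ω := fun N => measurable_pi_lambda _ (hX N)
  have hZb : ∀ N x, |Z N x| ≤ ∑ _p ∈ (Finset.univ : Finset (Fin (k * N))).offDiag, C := fun N x => by
    refine (Finset.abs_sum_le_sum_abs _ _).trans (Finset.sum_le_sum fun p _ => ?_)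
    rw [abs_mul]
    calc |w N p| * _ ≤ 1 * C := by
          gcongr
          · exact hw N p
          · exact hC _
      _ = C := one_mul C
  let Y : ℕ → Ω → ℝ := fun N ω => Z N (fun i => X N i ω) / ((k * N : ℕ) : ℝ) ^ 2
  have hYm : ∀ N, Measurable (Y N) := fun N => ((hZm N).comp (hXm N)).div_const _
  -- A variance of order `n ^ 2` divided by `n ^ 4` is summable in `N`, so the squares are almost
  -- surely summable with no assumption relating different `N`.
  have hY2 : ∀ N, ∫⁻ ω, ENNReal.ofReal (Y N ω ^ 2) ∂P ≤
      ENNReal.ofReal (2 * C ^ 2 * (1 / (N : ℝ) ^ 2)) := fun N => by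
    have hint : Integrable (fun ω => Y N ω ^ 2) P := by
      refine Integrable.of_bound ((hYm N).pow_const 2).aestronglyMeasurable
        (((∑ _p ∈ (Finset.univ : Finset (Fin (k * N))).offDiag, C) /
          ((k * N : ℕ) : ℝ) ^ 2) ^ 2) (Eventually.of_forall fun ω => ?_)
      rw [Real.norm_eq_abs, abs_pow, abs_div, abs_of_nonneg (sq_nonneg ((k * N : ℕ) : ℝ))]
      gcongr
      exact hZb N fun i => X N i ω
    rw [← ofReal_integral_eq_lintegral_ofReal hint (Eventually.of_forall fun ω => sq_nonneg _)]
    apply ENNReal.ofReal_le_ofReal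
    have h1 : ∫ ω, Z N (fun i => X N i ω) ^ 2 ∂P = ∫ x, Z N x ^ 2 ∂(Measure.pi fun _ => μ) := by
      rw [← hlaw N, integral_map (hXm N).aemeasurable]
      exact ((hZm N).pow_const 2).aestronglyMeasurable
    have h2 := integral_sq_sum_diff_le (μ := μ) hm hC h0 (w N) (hw N)
    have h3 : ∫ ω, Y N ω ^ 2 ∂P =
        (∫ ω, Z N (fun i => X N i ω) ^ 2 ∂P) / (((k * N : ℕ) : ℝ) ^ 2) ^ 2 := by
      rw [← integral_div]
      congr 1; ext ω; exact div_pow _ _ _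
    rw [h3, h1]
    rcases Nat.eq_zero_or_pos N with rfl | hN
    · simp
    have hN' : (0 : ℝ) < N := by exact_mod_cast hN
    have hk' : (1 : ℝ) ≤ k := by exact_mod_cast hk
    rw [Fintype.card_fin] at h2
    rw [div_le_iff₀ (by positivity)]
    refine h2.trans ?_
    push_cast
    have : 2 * C ^ 2 * (1 / (N : ℝ) ^ 2) * (((k : ℝ) * N) ^ 2) ^ 2 =
        (2 * C ^ 2 * (k * N) ^ 2) * (k : ℝ) ^ 2 := by field_simp
    rw [this]
    exact le_mul_of_one_le_right (by positivity) (one_le_pow₀ hk')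
  have hsum : ∫⁻ ω, ∑' N, ENNReal.ofReal (Y N ω ^ 2) ∂P ≠ ∞ := by
    rw [lintegral_tsum fun N => ((hYm N).pow_const 2).ennreal_ofReal.aemeasurable]
    refine ne_top_of_le_ne_top ?_ (ENNReal.tsum_le_tsum hY2)
    exact Summable.tsum_ofReal_ne_top
      ((Real.summable_one_div_nat_pow.2 one_lt_two).mul_left _)
  have hae := ae_lt_top
    (Measurable.tsum fun N => ((hYm N).pow_const 2).ennreal_ofReal) hsum
  filter_upwards [hae] with ω hω
  have h1 := ENNReal.tendsto_atTop_zero_of_tsum_ne_top hω.ne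
  have h2 : Tendsto (fun N => Y N ω ^ 2) atTop (𝓝 0) := by
    have := (ENNReal.tendsto_toReal ENNReal.zero_ne_top).comp h1
    simpa [Function.comp_def, ENNReal.toReal_ofReal (sq_nonneg _)] using this
  have h3 := h2.sqrt
  simp only [Real.sqrt_sq_eq_abs, Real.sqrt_zero] at h3
  exact (tendsto_zero_iff_abs_tendsto_zero _).2 h3

end UStatistic

/-! ### Cut-norm concentration of the adjacency matrix given the positions -/

section Concentration

/-- A Hoeffding-type bound for a centred Bernoulli variable. -/
theorem bernoulli_mgf_le {p s : ℝ} (hp : p ∈ Set.Icc (0 : ℝ) 1) (hs : |s| ≤ 1) :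
    p * Real.exp (s * (1 - p)) + (1 - p) * Real.exp (s * (0 - p)) ≤ Real.exp (s ^ 2) := by
  obtain ⟨hp0, hp1⟩ := hp
  have hexp : ∀ x : ℝ, |x| ≤ 1 → Real.exp x ≤ 1 + x + x ^ 2 := fun x hx => by
    have := (abs_le.1 (Real.abs_exp_sub_one_sub_id_le hx)).2
    linarith
  have h1 : |s * (1 - p)| ≤ 1 := by
    rw [abs_mul, abs_of_nonneg (by linarith : 0 ≤ 1 - p)]
    exact mul_le_one₀ hs (by linarith) (by linarith)
  have h2 : |s * (0 - p)| ≤ 1 := by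
    rw [abs_mul, zero_sub, abs_neg, abs_of_nonneg hp0]
    exact mul_le_one₀ hs hp0 hp1
  calc p * Real.exp (s * (1 - p)) + (1 - p) * Real.exp (s * (0 - p))
      ≤ p * (1 + s * (1 - p) + (s * (1 - p)) ^ 2)
        + (1 - p) * (1 + s * (0 - p) + (s * (0 - p)) ^ 2) := by
        gcongr
        · exact hexp _ h1
        · exact hexp _ h2
    _ = 1 + s ^ 2 * (p * (1 - p)) := by ring
    _ ≤ s ^ 2 + 1 := by
        have : p * (1 - p) ≤ 1 := by nlinarith
        nlinarith [sq_nonneg s]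
    _ ≤ Real.exp (s ^ 2) := Real.add_one_le_exp _

open scoped Classical in
/-- The sum over all graphs of a product over the pairs factorizes. -/
theorem sum_prod_adj_le {n : ℕ} (a b : Fin n → Fin n → ℝ) (ha : ∀ i j, 0 ≤ a i j)
    (hb : ∀ i j, 0 ≤ b i j) :
    ∑ H : SimpleGraph (Fin n), ∏ i, ∏ j ∈ Finset.Ioi i, (if H.Adj i j then a i j else b i j) ≤
      ∏ i, ∏ j ∈ Finset.Ioi i, (a i j + b i j) := by
  let E : Finset (Σ _ : Fin n, Fin n) := Finset.univ.sigma fun i => Finset.Ioi i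
  let τ : SimpleGraph (Fin n) → Finset (Σ _ : Fin n, Fin n) := fun H =>
    E.filter fun e => H.Adj e.1 e.2
  let g : Finset (Σ _ : Fin n, Fin n) → ℝ := fun t =>
    (∏ e ∈ t, a e.1 e.2) * ∏ e ∈ E \ t, b e.1 e.2
  have hτ : Function.Injective τ := by
    have haux : ∀ H H' : SimpleGraph (Fin n), τ H = τ H' → ∀ i j, i < j → H.Adj i j →
        H'.Adj i j := fun H H' h i j hij hadj => by
      have : (⟨i, j⟩ : Σ _ : Fin n, Fin n) ∈ τ H := by simp [τ, E, hij, hadj]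
      rw [h] at this
      exact (Finset.mem_filter.1 this).2
    have haux' : ∀ H H' : SimpleGraph (Fin n), τ H = τ H' → ∀ i j, H.Adj i j → H'.Adj i j :=
      fun H H' h i j hadj => by
        rcases lt_trichotomy i j with hij | rfl | hij
        · exact haux H H' h i j hij hadj
        · exact absurd rfl hadj.ne
        · exact (haux H H' h j i hij hadj.symm).symm
    intro H H' h
    ext i j
    exact ⟨haux' H H' h i j, haux' H' H h.symm i j⟩
  have h1 : ∀ H : SimpleGraph (Fin n),
      ∏ i, ∏ j ∈ Finset.Ioi i, (if H.Adj i j then a i j else b i j) = g (τ H) := fun H => by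
    rw [Finset.prod_sigma' Finset.univ (fun i => Finset.Ioi i)
      (fun i j => if H.Adj i j then a i j else b i j), Finset.prod_ite]
    congr 1
    refine Finset.prod_congr ?_ fun _ _ => rfl
    ext e
    simp only [τ, E, Finset.mem_filter, Finset.mem_sdiff]
    tauto
  -- Expanding the product gives one term per set of pairs `i < j`. Graphs embed into these sets,
  -- and the terms are nonnegative, so an inequality needs only injectivity.
  rw [Finset.prod_sigma' Finset.univ (fun i => Finset.Ioi i) (fun i j => a i j + b i j),
    Finset.prod_add]
  simp_rw [h1]
  rw [← Finset.sum_image (f := g) (g := τ) (s := Finset.univ) fun x _ y _ h => hτ h]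
  refine Finset.sum_le_sum_of_subset_of_nonneg (fun t ht => ?_) fun t _ _ => ?_
  · obtain ⟨H, -, rfl⟩ := Finset.mem_image.1 ht
    exact Finset.mem_powerset.2 (Finset.filter_subset _ _)
  · exact mul_nonneg (Finset.prod_nonneg fun e _ => ha _ _) (Finset.prod_nonneg fun e _ => hb _ _)

/-- The matrix of conditional connection probabilities, with zero diagonal. -/
def connMatrix {d k n : ℕ} (F : UnitAddTorus (Fin d) → Fin k → Fin k → ℝ) (σ : Fin n → Fin k)
    (x : Fin n → UnitAddTorus (Fin d)) : Matrix (Fin n) (Fin n) ℝ :=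
  Matrix.of fun i j => if i = j then 0 else F (x i - x j) (σ i) (σ j)

/-- The real number `1` or `-1`. -/
def signVal (u : ℤˣ) : ℝ := ((u : ℤ) : ℝ)

theorem abs_signVal (u : ℤˣ) : |signVal u| = 1 := by
  rcases Int.units_eq_one_or u with rfl | rfl <;> simp [signVal]

variable {d k n : ℕ} {F : UnitAddTorus (Fin d) → Fin k → Fin k → ℝ}

/-- A sum over all pairs off the diagonal as a sum over ordered pairs. -/
theorem sum_sum_eq_sum_Ioi (f : Fin n → Fin n → ℝ) (h0 : ∀ i, f i i = 0) :
    ∑ i, ∑ j, f i j = ∑ i, ∑ j ∈ Finset.Ioi i, (f i j + f j i) := by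
  have h1 : ∀ i, ∑ j, f i j = ∑ j ∈ Finset.Ioi i, f i j + ∑ j ∈ Finset.Iio i, f i j := fun i => by
    have : (Finset.univ : Finset (Fin n)) = Finset.Ioi i ∪ (Finset.Iio i ∪ {i}) := by
      ext j
      simp only [Finset.mem_univ, Finset.mem_union, Finset.mem_Ioi, Finset.mem_Iio,
        Finset.mem_singleton, true_iff]
      rcases lt_trichotomy i j with h | h | h <;> simp [h]
    rw [this, Finset.sum_union, Finset.sum_union, Finset.sum_singleton, h0, add_zero]
    · simp
    · rw [Finset.disjoint_left]
      intro j hj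
      simp only [Finset.mem_Ioi] at hj
      simp only [Finset.mem_union, Finset.mem_Iio, Finset.mem_singleton, not_or, not_lt]
      exact ⟨hj.le, hj.ne'⟩
  simp_rw [h1, Finset.sum_add_distrib]
  congr 1
  apply Finset.sum_comm'
  simp

open scoped Classical in
/-- Exponential bound for a fixed pair of sign vectors. -/
theorem sum_graphProb_bilin_le (hF : ∀ x a b, F x a b ∈ Set.Icc (0 : ℝ) 1)
    (hsymm : ∀ x a b, F (-x) b a = F x a b) (σ : Fin n → Fin k)
    (x : Fin n → UnitAddTorus (Fin d)) {δ : ℝ} (hδ : 0 < δ) (hδ4 : δ ≤ 4) (u v : Fin n → ℤˣ) :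
    ∑ H : SimpleGraph (Fin n), (if δ * (n : ℝ) ^ 2 < ∑ i, ∑ j,
        signVal (u i) * (H.adjMatrix ℝ - connMatrix F σ x) i j * signVal (v j)
      then graphProb F σ x H else 0) ≤ Real.exp (-(δ ^ 2 / 16 * (n : ℝ) ^ 2)) := by
  set p : Fin n → Fin n → ℝ := fun i j => F (x i - x j) (σ i) (σ j) with hp
  have hpI : ∀ i j, p i j ∈ Set.Icc (0 : ℝ) 1 := fun i j => hF _ _ _
  have hps : ∀ i j, p j i = p i j := fun i j => by
    simp only [hp]
    rw [← hsymm (x i - x j), neg_sub]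
  -- This minimizes the exponent `-s δ n ^ 2 + 4 s ^ 2 n ^ 2`, with value `-δ ^ 2 n ^ 2 / 16`; `δ ≤
  -- 4` keeps `|s * c i j| ≤ 1`.
  set s : ℝ := δ / 8 with hs
  -- By symmetry of the matrix, the unordered pair `{i, j}` enters the bilinear form once with this
  -- coefficient, and distinct pairs are conditionally independent.
  set c : Fin n → Fin n → ℝ := fun i j =>
    signVal (u i) * signVal (v j) + signVal (u j) * signVal (v i) with hc
  have hc2 : ∀ i j, |c i j| ≤ 2 := fun i j => by
    refine (abs_add_le _ _).trans ?_
    rw [abs_mul, abs_mul]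
    simp only [abs_signVal]
    norm_num
  have hsc : ∀ i j, |s * c i j| ≤ 1 := fun i j => by
    rw [abs_mul, abs_of_pos (by positivity : 0 < s)]
    have := hc2 i j
    calc s * |c i j| ≤ (4 / 8) * 2 := by
          gcongr
          rw [hs]; gcongr
      _ = 1 := by norm_num
  let ind : SimpleGraph (Fin n) → Fin n → Fin n → ℝ := fun H i j => if H.Adj i j then 1 else 0
  have hQ : ∀ H : SimpleGraph (Fin n), ∑ i, ∑ j,
      signVal (u i) * (H.adjMatrix ℝ - connMatrix F σ x) i j * signVal (v j) =
      ∑ i, ∑ j ∈ Finset.Ioi i, c i j * (ind H i j - p i j) := fun H => by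
    rw [sum_sum_eq_sum_Ioi]
    · refine Finset.sum_congr rfl fun i _ => Finset.sum_congr rfl fun j hj => ?_
      have hij : i ≠ j := (Finset.mem_Ioi.1 hj).ne
      simp only [Matrix.sub_apply, SimpleGraph.adjMatrix_apply, connMatrix, Matrix.of_apply, if_neg hij,
        if_neg hij.symm, hc, ind, H.adj_comm j i]
      have : F (x j - x i) (σ j) (σ i) = F (x i - x j) (σ i) (σ j) := hps i j
      rw [this]
      ring
    · intro i
      simp [connMatrix]
  have hg0 : ∀ H, 0 ≤ graphProb F σ x H := fun H =>
    Finset.prod_nonneg fun i _ => Finset.prod_nonneg fun j _ => by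
      have := hpI i j
      split_ifs
      · exact this.1
      · exact sub_nonneg.2 this.2
  have hcount : ∑ i : Fin n, ∑ j ∈ Finset.Ioi i, (4 * s ^ 2 : ℝ) ≤ 4 * s ^ 2 * (n : ℝ) ^ 2 := by
    calc ∑ i : Fin n, ∑ j ∈ Finset.Ioi i, (4 * s ^ 2 : ℝ)
        ≤ ∑ _i : Fin n, ∑ _j : Fin n, (4 * s ^ 2 : ℝ) :=
          Finset.sum_le_sum fun i _ => Finset.sum_le_sum_of_subset_of_nonneg
            (Finset.subset_univ _) fun _ _ _ => by positivity
      _ = 4 * s ^ 2 * (n : ℝ) ^ 2 := by simp; ring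
  calc ∑ H : SimpleGraph (Fin n), (if δ * (n : ℝ) ^ 2 < ∑ i, ∑ j,
        signVal (u i) * (H.adjMatrix ℝ - connMatrix F σ x) i j * signVal (v j)
      then graphProb F σ x H else 0)
      ≤ ∑ H : SimpleGraph (Fin n), Real.exp (-(s * (δ * (n : ℝ) ^ 2))) *
          ∏ i, ∏ j ∈ Finset.Ioi i, (if H.Adj i j then p i j * Real.exp (s * c i j * (1 - p i j))
            else (1 - p i j) * Real.exp (s * c i j * (0 - p i j))) := by
        -- Chernoff: the indicator of the event is at most `exp (s * (form - δ * n ^ 2))`.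
        refine Finset.sum_le_sum fun H _ => ?_
        have hprod : ∏ i, ∏ j ∈ Finset.Ioi i,
            (if H.Adj i j then p i j * Real.exp (s * c i j * (1 - p i j))
              else (1 - p i j) * Real.exp (s * c i j * (0 - p i j))) =
            graphProb F σ x H *
              Real.exp (s * ∑ i, ∑ j ∈ Finset.Ioi i, c i j * (ind H i j - p i j)) := by
          rw [Finset.mul_sum, Real.exp_sum, graphProb, ← Finset.prod_mul_distrib]
          refine Finset.prod_congr rfl fun i _ => ?_
          rw [Finset.mul_sum, Real.exp_sum, ← Finset.prod_mul_distrib]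
          refine Finset.prod_congr rfl fun j _ => ?_
          by_cases hadj : H.Adj i j <;> simp [hadj, ind, hp, mul_assoc]
        rw [hprod, hQ]
        split_ifs with hlt
        · rw [mul_left_comm, ← Real.exp_add]
          refine le_mul_of_one_le_right (hg0 H) (Real.one_le_exp ?_)
          have : s * (δ * (n : ℝ) ^ 2) ≤
              s * ∑ i, ∑ j ∈ Finset.Ioi i, c i j * (ind H i j - p i j) := by gcongr
          linarith
        · exact mul_nonneg (Real.exp_nonneg _) (mul_nonneg (hg0 H) (Real.exp_nonneg _))
    _ ≤ Real.exp (-(s * (δ * (n : ℝ) ^ 2))) * ∏ i, ∏ j ∈ Finset.Ioi i,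
          (p i j * Real.exp (s * c i j * (1 - p i j)) +
            (1 - p i j) * Real.exp (s * c i j * (0 - p i j))) := by
        rw [← Finset.mul_sum]
        refine mul_le_mul_of_nonneg_left (sum_prod_adj_le _ _ (fun i j => ?_) fun i j => ?_)
          (Real.exp_nonneg _)
        · exact mul_nonneg (hpI i j).1 (Real.exp_nonneg _)
        · exact mul_nonneg (sub_nonneg.2 (hpI i j).2) (Real.exp_nonneg _)
    _ ≤ Real.exp (-(s * (δ * (n : ℝ) ^ 2))) *
          ∏ i : Fin n, ∏ j ∈ Finset.Ioi i, Real.exp (4 * s ^ 2) := by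
        gcongr with i _ j _
        · intro i _
          refine Finset.prod_nonneg fun j _ => ?_
          exact add_nonneg (mul_nonneg (hpI i j).1 (Real.exp_nonneg _))
            (mul_nonneg (sub_nonneg.2 (hpI i j).2) (Real.exp_nonneg _))
        · intro j _
          exact add_nonneg (mul_nonneg (hpI i j).1 (Real.exp_nonneg _))
            (mul_nonneg (sub_nonneg.2 (hpI i j).2) (Real.exp_nonneg _))
        · refine (bernoulli_mgf_le (hpI i j) (hsc i j)).trans (Real.exp_le_exp.2 ?_)
          have h4 : c i j ^ 2 ≤ 2 ^ 2 := sq_le_sq' (abs_le.1 (hc2 i j)).1 (abs_le.1 (hc2 i j)).2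
          rw [mul_pow]
          nlinarith [sq_nonneg s]
    _ ≤ Real.exp (-(δ ^ 2 / 16 * (n : ℝ) ^ 2)) := by
        simp_rw [← Real.exp_sum]
        rw [← Real.exp_add, Real.exp_le_exp]
        have : -(δ ^ 2 / 16 * (n : ℝ) ^ 2) =
            -(s * (δ * (n : ℝ) ^ 2)) + 4 * s ^ 2 * (n : ℝ) ^ 2 := by rw [hs]; ring
        linarith

/-- The bilinear form of the centred adjacency matrix is at most `K` on all sign vectors. -/
def BilinLE (D : Matrix (Fin n) (Fin n) ℝ) (K : ℝ) : Prop :=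
  ∀ u v : Fin n → ℤˣ, ∑ i, ∑ j, signVal (u i) * D i j * signVal (v j) ≤ K

open scoped Classical in
/-- The conditional probability that the centred adjacency matrix has a large bilinear form. -/
theorem sum_graphProb_not_bilinLE_le (hF : ∀ x a b, F x a b ∈ Set.Icc (0 : ℝ) 1)
    (hsymm : ∀ x a b, F (-x) b a = F x a b) (σ : Fin n → Fin k)
    (x : Fin n → UnitAddTorus (Fin d)) {δ : ℝ} (hδ : 0 < δ) (hδ4 : δ ≤ 4) :
    ∑ H : SimpleGraph (Fin n), (if ¬ BilinLE (H.adjMatrix ℝ - connMatrix F σ x) (δ * (n : ℝ) ^ 2)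
      then graphProb F σ x H else 0) ≤ 4 ^ n * Real.exp (-(δ ^ 2 / 16 * (n : ℝ) ^ 2)) := by
  have hg0 : ∀ H, 0 ≤ graphProb F σ x H := fun H =>
    Finset.prod_nonneg fun i _ => Finset.prod_nonneg fun j _ => by
      have := hF (x i - x j) (σ i) (σ j)
      split_ifs
      · exact this.1
      · exact sub_nonneg.2 this.2
  calc ∑ H : SimpleGraph (Fin n),
        (if ¬ BilinLE (H.adjMatrix ℝ - connMatrix F σ x) (δ * (n : ℝ) ^ 2)
          then graphProb F σ x H else 0)
      ≤ ∑ H : SimpleGraph (Fin n), ∑ u : Fin n → ℤˣ, ∑ v : Fin n → ℤˣ,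
          (if δ * (n : ℝ) ^ 2 < ∑ i, ∑ j,
            signVal (u i) * (H.adjMatrix ℝ - connMatrix F σ x) i j * signVal (v j)
          then graphProb F σ x H else 0) := by
        refine Finset.sum_le_sum fun H _ => ?_
        have h0 : ∀ u v : Fin n → ℤˣ, 0 ≤ (if δ * (n : ℝ) ^ 2 < ∑ i, ∑ j,
            signVal (u i) * (H.adjMatrix ℝ - connMatrix F σ x) i j * signVal (v j)
          then graphProb F σ x H else 0) := fun u v => by
          split_ifs
          · exact hg0 H
          · exact le_rfl
        split_ifs with hbad
        · exact Finset.sum_nonneg fun u _ => Finset.sum_nonneg fun v _ => h0 u v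
        · simp only [BilinLE, not_forall, not_le] at hbad
          obtain ⟨u, v, huv⟩ := hbad
          refine le_trans ?_ (Finset.single_le_sum
            (fun u _ => Finset.sum_nonneg fun v _ => h0 u v) (Finset.mem_univ u))
          refine le_trans ?_ (Finset.single_le_sum (fun v _ => h0 u v) (Finset.mem_univ v))
          rw [if_pos huv]
    _ = ∑ u : Fin n → ℤˣ, ∑ v : Fin n → ℤˣ, ∑ H : SimpleGraph (Fin n),
          (if δ * (n : ℝ) ^ 2 < ∑ i, ∑ j,
            signVal (u i) * (H.adjMatrix ℝ - connMatrix F σ x) i j * signVal (v j)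
          then graphProb F σ x H else 0) := by
        rw [Finset.sum_comm]
        exact Finset.sum_congr rfl fun u _ => Finset.sum_comm
    _ ≤ ∑ _u : Fin n → ℤˣ, ∑ _v : Fin n → ℤˣ, Real.exp (-(δ ^ 2 / 16 * (n : ℝ) ^ 2)) :=
        Finset.sum_le_sum fun u _ => Finset.sum_le_sum fun v _ =>
          sum_graphProb_bilin_le hF hsymm σ x hδ hδ4 u v
    _ = 4 ^ n * Real.exp (-(δ ^ 2 / 16 * (n : ℝ) ^ 2)) := by
        simp only [Finset.sum_const, Finset.card_univ, Fintype.card_pi, Fintype.card_units_int,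
          Finset.prod_const, Fintype.card_fin, nsmul_eq_mul]
        rw [← mul_assoc]
        congr 1
        push_cast
        rw [← mul_pow]; norm_num

open scoped Classical in
/-- The probability that the centred adjacency matrix has a large bilinear form. -/
theorem IsSGBM.measure_not_bilinLE_le {Ω : Type*} [MeasurableSpace Ω] {P : Measure Ω}
    [IsProbabilityMeasure P] (hF : ∀ x a b, F x a b ∈ Set.Icc (0 : ℝ) 1)
    (hFm : ∀ a b, Measurable fun x => F x a b)
    (hsymm : ∀ x a b, F (-x) b a = F x a b) {σ : Fin n → Fin k}
    {X : Fin n → Ω → UnitAddTorus (Fin d)} {G : Ω → SimpleGraph (Fin n)}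
    (hG : IsSGBM P F σ X G) {δ : ℝ} (hδ : 0 < δ) (hδ4 : δ ≤ 4) :
    P {ω | ¬ BilinLE ((G ω).adjMatrix ℝ - connMatrix F σ fun i => X i ω) (δ * (n : ℝ) ^ 2)} ≤
      ENNReal.ofReal (4 ^ n * Real.exp (-(δ ^ 2 / 16 * (n : ℝ) ^ 2))) := by
  let B : SimpleGraph (Fin n) → Set (Fin n → UnitAddTorus (Fin d)) := fun H =>
    {x | ¬ BilinLE (H.adjMatrix ℝ - connMatrix F σ x) (δ * (n : ℝ) ^ 2)}
  have hpm : ∀ i j, Measurable fun x : Fin n → UnitAddTorus (Fin d) =>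
      F (x i - x j) (σ i) (σ j) := fun i j =>
    (hFm _ _).comp ((measurable_pi_apply i).sub (measurable_pi_apply j))
  have hgm : ∀ H, Measurable fun x => graphProb F σ x H := fun H => by
    refine Finset.measurable_prod _ fun i _ => Finset.measurable_prod _ fun j _ => ?_
    split_ifs
    · exact hpm i j
    · exact measurable_const.sub (hpm i j)
  have hBm : ∀ H, MeasurableSet (B H) := fun H => by
    have hB : B H = (⋂ u : Fin n → ℤˣ, ⋂ v : Fin n → ℤˣ, {x | ∑ i, ∑ j, signVal (u i) *
        (H.adjMatrix ℝ - connMatrix F σ x) i j * signVal (v j) ≤ δ * (n : ℝ) ^ 2})ᶜ := by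
      ext x
      simp [B, BilinLE]
    rw [hB]
    refine MeasurableSet.compl ?_
    refine MeasurableSet.iInter fun u => MeasurableSet.iInter fun v =>
      measurableSet_le ?_ measurable_const
    refine Finset.measurable_sum _ fun i _ => Finset.measurable_sum _ fun j _ => ?_
    refine Measurable.mul_const (Measurable.const_mul ?_ _) _
    simp only [Matrix.sub_apply, connMatrix, Matrix.of_apply]
    refine measurable_const.sub ?_
    split_ifs
    · exact measurable_const
    · exact hpm i j
  have hXm : Measurable fun ω i => X i ω := measurable_pi_lambda _ hG.measurable_position
  have hg0 : ∀ x H, 0 ≤ graphProb F σ x H := fun x H =>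
    Finset.prod_nonneg fun i _ => Finset.prod_nonneg fun j _ => by
      have := hF (x i - x j) (σ i) (σ j)
      split_ifs
      · exact this.1
      · exact sub_nonneg.2 this.2
  calc P {ω | ¬ BilinLE ((G ω).adjMatrix ℝ - connMatrix F σ fun i => X i ω) (δ * (n : ℝ) ^ 2)}
      ≤ P (⋃ H, {ω | (fun i => X i ω) ∈ B H ∧ G ω = H}) :=
        measure_mono fun ω hω => Set.mem_iUnion.2 ⟨G ω, hω, rfl⟩
    _ ≤ ∑ H, P {ω | (fun i => X i ω) ∈ B H ∧ G ω = H} := measure_iUnion_fintype_le _ _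
    -- Splitting by the value of the graph turns the event into conditions on the positions alone,
    -- where `graph_law` applies.
    _ = ∑ H, ∫⁻ ω, ENNReal.ofReal (if (fun i => X i ω) ∈ B H
          then graphProb F σ (fun i => X i ω) H else 0) ∂P := by
        refine Finset.sum_congr rfl fun H _ => ?_
        have hpre : MeasurableSet {ω | (fun i => X i ω) ∈ B H} := hXm (hBm H)
        rw [hG.graph_law H (B H) (hBm H), ← lintegral_indicator hpre]
        refine lintegral_congr fun ω => ?_
        by_cases hω : (fun i => X i ω) ∈ B H <;> simp [hω]
    _ = ∫⁻ ω, ∑ H, ENNReal.ofReal (if (fun i => X i ω) ∈ B H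
          then graphProb F σ (fun i => X i ω) H else 0) ∂P := by
        rw [lintegral_finsetSum]
        intro H _
        exact ((Measurable.ite (hBm H) (hgm H) measurable_const).comp hXm).ennreal_ofReal
    _ ≤ ∫⁻ _, ENNReal.ofReal (4 ^ n * Real.exp (-(δ ^ 2 / 16 * (n : ℝ) ^ 2))) ∂P := by
        refine lintegral_mono fun ω => ?_
        rw [← ENNReal.ofReal_sum_of_nonneg]
        · exact ENNReal.ofReal_le_ofReal
            (sum_graphProb_not_bilinLE_le hF hsymm σ (fun i => X i ω) hδ hδ4)
        · intro H _
          split_ifs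
          · exact hg0 _ _
          · exact le_rfl
    _ = _ := by simp

open scoped Classical in
/-- Almost surely the centred adjacency matrices are `o(n²)` on sign vectors. -/
theorem ae_eventually_bilinLE {Ω : Type*} [MeasurableSpace Ω] {P : Measure Ω}
    [IsProbabilityMeasure P] (hk : 0 < k) (hF : ∀ x a b, F x a b ∈ Set.Icc (0 : ℝ) 1)
    (hFm : ∀ a b, Measurable fun x => F x a b)
    (hsymm : ∀ x a b, F (-x) b a = F x a b) {σ : ∀ N : ℕ, Fin (k * N) → Fin k}
    {X : ∀ N : ℕ, Fin (k * N) → Ω → UnitAddTorus (Fin d)}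
    {G : ∀ N : ℕ, Ω → SimpleGraph (Fin (k * N))}
    (hG : ∀ N, IsSGBM P F (σ N) (X N) (G N)) :
    ∀ᵐ ω ∂P, ∀ δ : ℝ, 0 < δ → ∀ᶠ N : ℕ in atTop,
      BilinLE ((G N ω).adjMatrix ℝ - connMatrix F (σ N) fun i => X N i ω)
        (δ * ((k * N : ℕ) : ℝ) ^ 2) := by
  -- Countably many thresholds `1 / (m + 1)` suffice for all `δ > 0`.
  have hstep : ∀ m : ℕ, ∀ᵐ ω ∂P, ∀ᶠ N : ℕ in atTop,
      BilinLE ((G N ω).adjMatrix ℝ - connMatrix F (σ N) fun i => X N i ω)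
        (1 / ((m : ℝ) + 1) * ((k * N : ℕ) : ℝ) ^ 2) := fun m => by
    set δ : ℝ := 1 / ((m : ℝ) + 1) with hδdef
    have hδ : 0 < δ := by positivity
    have hδ4 : δ ≤ 4 := by
      rw [hδdef, div_le_iff₀ (by positivity)]
      have : (0 : ℝ) ≤ m := by positivity
      linarith
    have hsum : Summable fun N : ℕ =>
        (4 : ℝ) ^ (k * N) * Real.exp (-(δ ^ 2 / 16 * ((k * N : ℕ) : ℝ) ^ 2)) := by
      refine Summable.of_norm_bounded_eventually_nat Real.summable_exp_neg_nat ?_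
      obtain ⟨N0, hN0⟩ := exists_nat_gt ((Real.log 4 + 1) / (δ ^ 2 / 16))
      filter_upwards [eventually_ge_atTop N0] with N hN
      have hkN : N ≤ k * N := Nat.le_mul_of_pos_left N hk
      have hkN' : (N : ℝ) ≤ ((k * N : ℕ) : ℝ) := by exact_mod_cast hkN
      set n : ℝ := ((k * N : ℕ) : ℝ) with hn
      -- Multiplied by `n`, this bounds the probability by `exp (-n) ≤ exp (-N)`.
      have hbig : Real.log 4 + 1 < δ ^ 2 / 16 * n := by
        rw [div_lt_iff₀ (by positivity)] at hN0
        have : (N0 : ℝ) ≤ N := by exact_mod_cast hN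
        have h2 : (N0 : ℝ) * (δ ^ 2 / 16) ≤ n * (δ ^ 2 / 16) := by
          gcongr; linarith
        linarith
      rw [Real.norm_of_nonneg (by positivity)]
      have h4 : (4 : ℝ) ^ (k * N) = Real.exp (n * Real.log 4) := by
        rw [hn, Real.exp_nat_mul, Real.exp_log (by norm_num)]
      rw [h4, ← Real.exp_add]
      apply Real.exp_le_exp.2
      have hn0 : 0 ≤ n := by positivity
      nlinarith [mul_le_mul_of_nonneg_left hbig.le hn0]
    have := ae_eventually_notMem (μ := P) (s := fun N =>
      {ω | ¬ BilinLE ((G N ω).adjMatrix ℝ - connMatrix F (σ N) fun i => X N i ω)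
        (δ * ((k * N : ℕ) : ℝ) ^ 2)}) (ne_top_of_le_ne_top hsum.tsum_ofReal_ne_top
          (ENNReal.tsum_le_tsum fun N => (hG N).measure_not_bilinLE_le hF hFm hsymm hδ hδ4))
    filter_upwards [this] with ω hω
    filter_upwards [hω] with N hN
    simpa using hN
  filter_upwards [ae_all_iff.2 hstep] with ω hω δ hδ
  obtain ⟨m, hm⟩ := exists_nat_one_div_lt hδ
  filter_upwards [hω m] with N hN u v
  refine (hN u v).trans ?_
  gcongr

end Concentration

/-! ### Stability of traces of powers in cut norm -/

section Traces

variable {n : ℕ}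

/-- A linear form on the cube is maximal at a sign vector. -/
theorem exists_sign_sum_le (a : Fin n → ℝ) : ∃ s : Fin n → ℤˣ, ∀ u : Fin n → ℝ,
    (∀ i, |u i| ≤ 1) → ∑ i, u i * a i ≤ ∑ i, signVal (s i) * a i := by
  refine ⟨fun i => if 0 ≤ a i then 1 else -1, fun u hu => Finset.sum_le_sum fun i _ => ?_⟩
  obtain ⟨h1, h2⟩ := abs_le.1 (hu i)
  by_cases h : 0 ≤ a i
  · simp only [h, if_true, signVal, Units.val_one, Int.cast_one]
    exact mul_le_mul_of_nonneg_right h2 h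
  · simp only [h, if_false, signVal, Units.val_neg, Units.val_one, Int.cast_neg, Int.cast_one]
    exact mul_le_mul_of_nonpos_right h1 (le_of_not_ge h)

/-- A bilinear form is linear in each argument separately, so its maximum over the product of two
cubes is reached at vertices. -/
theorem BilinLE.sum_le {D : Matrix (Fin n) (Fin n) ℝ} {K : ℝ} (hD : BilinLE D K)
    {u v : Fin n → ℝ} (hu : ∀ i, |u i| ≤ 1) (hv : ∀ i, |v i| ≤ 1) :
    ∑ i, ∑ j, u i * D i j * v j ≤ K := by
  obtain ⟨s, hs⟩ := exists_sign_sum_le fun i => ∑ j, D i j * v j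
  obtain ⟨t, ht⟩ := exists_sign_sum_le fun j => ∑ i, signVal (s i) * D i j
  calc ∑ i, ∑ j, u i * D i j * v j = ∑ i, u i * ∑ j, D i j * v j := by
        simp_rw [Finset.mul_sum, mul_assoc]
    _ ≤ ∑ i, signVal (s i) * ∑ j, D i j * v j := hs u hu
    _ = ∑ j, v j * ∑ i, signVal (s i) * D i j := by
        simp_rw [Finset.mul_sum]
        rw [Finset.sum_comm]
        exact Finset.sum_congr rfl fun j _ => Finset.sum_congr rfl fun i _ => by ring
    _ ≤ ∑ j, signVal (t j) * ∑ i, signVal (s i) * D i j := ht v hv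
    _ = ∑ i, ∑ j, signVal (s i) * D i j * signVal (t j) := by
        simp_rw [Finset.mul_sum]
        rw [Finset.sum_comm]
        exact Finset.sum_congr rfl fun j _ => Finset.sum_congr rfl fun i _ => by ring
    _ ≤ K := hD s t

theorem BilinLE.abs_sum_le {D : Matrix (Fin n) (Fin n) ℝ} {K : ℝ} (hD : BilinLE D K)
    {u v : Fin n → ℝ} (hu : ∀ i, |u i| ≤ 1) (hv : ∀ i, |v i| ≤ 1) :
    |∑ i, ∑ j, u i * D i j * v j| ≤ K := by
  refine abs_le'.2 ⟨hD.sum_le hu hv, ?_⟩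
  have := hD.sum_le (u := fun i => -u i) (fun i => by simpa using hu i) hv
  simpa [Finset.sum_neg_distrib] using this

/-- The trace is a sum over `l` of the bilinear form of `D` at row `l` of `B` and column `l` of `A`;
divided by `c`, these vectors lie in the unit cube. -/
theorem BilinLE.abs_trace_mul_mul_le {D A B : Matrix (Fin n) (Fin n) ℝ} {K c : ℝ}
    (hD : BilinLE D K) (hc : 0 < c) (hA : ∀ i j, |A i j| ≤ c) (hB : ∀ i j, |B i j| ≤ c) :
    |(D * (A * B)).trace| ≤ n * (c ^ 2 * K) := by
  have h1 : (D * (A * B)).trace =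
      ∑ l, c ^ 2 * ∑ i, ∑ j, (B l i / c) * D i j * (A j l / c) := by
    simp only [Matrix.trace, Matrix.diag, Matrix.mul_apply, Finset.mul_sum]
    rw [Finset.sum_comm' (t' := Finset.univ) (s' := fun _ => Finset.univ) (by simp)]
    conv_rhs => rw [Finset.sum_comm]; enter [2, i]; rw [Finset.sum_comm]
    rw [Finset.sum_comm]
    refine Finset.sum_congr rfl fun i _ => Finset.sum_congr rfl fun j _ =>
      Finset.sum_congr rfl fun l _ => ?_
    field_simp
  rw [h1]
  refine (Finset.abs_sum_le_sum_abs _ _).trans ?_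
  calc ∑ l : Fin n, |c ^ 2 * ∑ i, ∑ j, (B l i / c) * D i j * (A j l / c)|
      ≤ ∑ _l : Fin n, c ^ 2 * K := by
        refine Finset.sum_le_sum fun l _ => ?_
        rw [abs_mul, abs_of_nonneg (sq_nonneg c)]
        refine mul_le_mul_of_nonneg_left (hD.abs_sum_le (fun i => ?_) fun j => ?_) (sq_nonneg c)
        · rw [abs_div, abs_of_pos hc]; exact div_le_one_of_le₀ (hB l i) hc.le
        · rw [abs_div, abs_of_pos hc]; exact div_le_one_of_le₀ (hA j l) hc.le
    _ = n * (c ^ 2 * K) := by simp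

theorem pow_sub_pow_eq_sum {R : Type*} [Ring R] (a b : R) (m : ℕ) :
    a ^ m - b ^ m = ∑ s ∈ Finset.range m, a ^ s * (a - b) * b ^ (m - 1 - s) := by
  induction m with
  | zero => simp
  | succ m ih =>
    rw [Finset.sum_range_succ]
    have h : ∑ s ∈ Finset.range m, a ^ s * (a - b) * b ^ (m + 1 - 1 - s) =
        (∑ s ∈ Finset.range m, a ^ s * (a - b) * b ^ (m - 1 - s)) * b := by
      rw [Finset.sum_mul]
      refine Finset.sum_congr rfl fun s hs => ?_
      have : m + 1 - 1 - s = (m - 1 - s) + 1 := by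
        have := Finset.mem_range.1 hs
        omega
      rw [this, pow_succ, mul_assoc (a ^ s * (a - b))]
    rw [h, ← ih]
    simp only [Nat.add_sub_cancel, Nat.sub_self, pow_zero, mul_one]
    rw [pow_succ, pow_succ]
    noncomm_ring

/-- Each entry of the product is a sum of `n` terms of size at most `n⁻¹ * n⁻¹`, so the bound `n⁻¹`
survives multiplication. -/
theorem abs_mul_apply_le_inv {A B : Matrix (Fin n) (Fin n) ℝ}
    (hA : ∀ i j, |A i j| ≤ (n : ℝ)⁻¹) (hB : ∀ i j, |B i j| ≤ (n : ℝ)⁻¹) (i j : Fin n) :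
    |(A * B) i j| ≤ (n : ℝ)⁻¹ := by
  have hn : (0 : ℝ) < n := by exact_mod_cast i.pos
  rw [Matrix.mul_apply]
  calc |∑ l, A i l * B l j| ≤ ∑ l, |A i l * B l j| := Finset.abs_sum_le_sum_abs _ _
    _ ≤ ∑ _l : Fin n, (n : ℝ)⁻¹ * (n : ℝ)⁻¹ := by
        refine Finset.sum_le_sum fun l _ => ?_
        rw [abs_mul]
        exact mul_le_mul (hA _ _) (hB _ _) (abs_nonneg _) (by positivity)
    _ = (n : ℝ)⁻¹ := by
        simp only [Finset.sum_const, Finset.card_univ, Fintype.card_fin, nsmul_eq_mul]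
        field_simp

theorem abs_pow_mul_pow_apply_le {A B : Matrix (Fin n) (Fin n) ℝ}
    (hA : ∀ i j, |A i j| ≤ (n : ℝ)⁻¹) (hB : ∀ i j, |B i j| ≤ (n : ℝ)⁻¹) (s t : ℕ)
    (hst : 1 ≤ t + s) : ∀ i j, |(B ^ t * A ^ s) i j| ≤ (n : ℝ)⁻¹ := by
  have hpow : ∀ {A : Matrix (Fin n) (Fin n) ℝ}, (∀ i j, |A i j| ≤ (n : ℝ)⁻¹) → ∀ s : ℕ,
      ∀ i j, |(A ^ (s + 1)) i j| ≤ (n : ℝ)⁻¹ := fun {A} hA s => by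
    induction s with
    | zero => simpa using hA
    | succ s ih => rw [pow_succ]; exact abs_mul_apply_le_inv ih hA
  rcases s with _ | s
  · obtain ⟨t, rfl⟩ : ∃ r, t = r + 1 := ⟨t - 1, by omega⟩
    simpa using hpow hB t
  · rcases t with _ | t
    · simpa using hpow hA s
    · exact abs_mul_apply_le_inv (hpow hB t) (hpow hA s)

/-- Traces of powers, from the third on, are stable under perturbations that are small on sign
vectors. -/
theorem BilinLE.abs_trace_pow_sub_le {A B : Matrix (Fin n) (Fin n) ℝ} {δ : ℝ}
    (hA : ∀ i j, |A i j| ≤ (n : ℝ)⁻¹) (hB : ∀ i j, |B i j| ≤ (n : ℝ)⁻¹)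
    (hD : BilinLE (A - B) (δ * n)) (hn : 0 < n) {m : ℕ} (hm : 3 ≤ m) :
    |(A ^ m).trace - (B ^ m).trace| ≤ m * δ := by
  have hn' : (0 : ℝ) < n := by exact_mod_cast hn
  rw [← Matrix.trace_sub, pow_sub_pow_eq_sum, Matrix.trace_sum]
  refine (Finset.abs_sum_le_sum_abs _ _).trans ?_
  calc ∑ s ∈ Finset.range m, |(A ^ s * (A - B) * B ^ (m - 1 - s)).trace|
      ≤ ∑ _s ∈ Finset.range m, δ := by
        refine Finset.sum_le_sum fun s hs => ?_
        have hs' := Finset.mem_range.1 hs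
        -- After a cyclic rotation, `m - 1 ≥ 2` factors remain next to `A - B`, enough for two
        -- nonempty products with entries at most `n⁻¹`. This is where `3 ≤ m` enters.
        obtain ⟨Q, R, hQ, hR, hQR⟩ : ∃ Q R : Matrix (Fin n) (Fin n) ℝ,
            (∀ i j, |Q i j| ≤ (n : ℝ)⁻¹) ∧ (∀ i j, |R i j| ≤ (n : ℝ)⁻¹) ∧
              B ^ (m - 1 - s) * A ^ s = Q * R := by
          by_cases h : m - 1 - s = 0
          · obtain ⟨r, rfl⟩ : ∃ r, s = r + 1 := ⟨s - 1, by omega⟩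
            refine ⟨A, A ^ r, hA, ?_, ?_⟩
            · simpa using abs_pow_mul_pow_apply_le hA hB r 0 (by omega)
            · rw [h, pow_zero, one_mul, pow_succ']
          · obtain ⟨r, hr⟩ : ∃ r, m - 1 - s = r + 1 := ⟨m - 1 - s - 1, by omega⟩
            refine ⟨B, B ^ r * A ^ s, hB, abs_pow_mul_pow_apply_le hA hB s r (by omega), ?_⟩
            rw [hr, pow_succ', mul_assoc]
        rw [mul_assoc, Matrix.trace_mul_comm, mul_assoc, hQR]
        refine (hD.abs_trace_mul_mul_le (inv_pos.2 hn') hQ hR).trans (le_of_eq ?_)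
        field_simp
    _ = m * δ := by simp

end Traces

/-! ### Stability of traces of powers in Hilbert-Schmidt norm -/

section Frobenius

open scoped Matrix.Norms.Frobenius

variable {ι : Type*} [Fintype ι] [DecidableEq ι]

theorem frobenius_norm_sq (A : Matrix ι ι ℂ) : ‖A‖ ^ 2 = ∑ i, ∑ j, ‖A i j‖ ^ 2 := by
  rw [Matrix.frobenius_norm_def, ← Real.sqrt_eq_rpow, Real.sq_sqrt]
  · simp
  · positivity

theorem norm_trace_mul_le (A B : Matrix ι ι ℂ) : ‖(A * B).trace‖ ≤ ‖A‖ * ‖B‖ := by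
  have h1 : ‖(A * B).trace‖ ≤ ∑ p : ι × ι, ‖A p.1 p.2‖ * ‖B p.2 p.1‖ := by
    rw [Fintype.sum_prod_type]
    simp only [Matrix.trace, Matrix.diag, Matrix.mul_apply]
    refine (norm_sum_le _ _).trans (Finset.sum_le_sum fun i _ => ?_)
    refine (norm_sum_le _ _).trans (Finset.sum_le_sum fun j _ => ?_)
    exact norm_mul_le _ _
  have h2 := Real.sum_mul_le_sqrt_mul_sqrt (Finset.univ : Finset (ι × ι))
    (fun p => ‖A p.1 p.2‖) fun p => ‖B p.2 p.1‖
  have hA : ∑ p : ι × ι, ‖A p.1 p.2‖ ^ 2 = ‖A‖ ^ 2 := by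
    rw [frobenius_norm_sq, Fintype.sum_prod_type]
  have hB : ∑ p : ι × ι, ‖B p.2 p.1‖ ^ 2 = ‖B‖ ^ 2 := by
    rw [frobenius_norm_sq, Fintype.sum_prod_type, Finset.sum_comm]
  rw [hA, hB, Real.sqrt_sq (norm_nonneg _), Real.sqrt_sq (norm_nonneg _)] at h2
  exact h1.trans h2

/-- Traces of powers, from the second on, are stable in the Hilbert-Schmidt norm. -/
theorem norm_trace_pow_sub_le {A B : Matrix ι ι ℂ} {η : ℝ} (hη0 : 0 ≤ η) (hη1 : η ≤ 1)
    (hA : ∑ i, ∑ j, ‖A i j‖ ^ 2 ≤ 1) (hAB : ∑ i, ∑ j, ‖(A - B) i j‖ ^ 2 ≤ η ^ 2) (m : ℕ) :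
    ‖(A ^ (m + 2)).trace - (B ^ (m + 2)).trace‖ ≤ (m + 2) * 2 ^ (m + 1) * η := by
  rw [← frobenius_norm_sq] at hA hAB
  have hA1 : ‖A‖ ≤ 1 := by
    have := abs_le_of_sq_le_sq (a := ‖A‖) (b := 1) (by simpa using hA) zero_le_one
    exact (le_abs_self _).trans this
  have hD : ‖A - B‖ ≤ η := (le_abs_self _).trans (abs_le_of_sq_le_sq hAB hη0)
  have hB2 : ‖B‖ ≤ 2 := by
    have : ‖B‖ ≤ ‖A‖ + ‖A - B‖ := by
      have h := norm_sub_le A (A - B)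
      rwa [sub_sub_cancel] at h
    linarith
  have hBpow : ∀ m : ℕ, ‖B ^ (m + 1)‖ ≤ 2 ^ (m + 1) := fun m =>
    (norm_pow_le' B m.succ_pos).trans (pow_le_pow_left₀ (norm_nonneg _) hB2 _)
  have hsplit : ∀ m : ℕ, A ^ (m + 1) - B ^ (m + 1) = A * (A ^ m - B ^ m) + (A - B) * B ^ m :=
    fun m => by rw [pow_succ', pow_succ']; noncomm_ring
  have hdiff : ∀ m : ℕ, ‖A ^ (m + 1) - B ^ (m + 1)‖ ≤ (m + 1) * 2 ^ m * η := fun m => by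
    induction m with
    | zero => simpa using hD
    | succ m ih =>
      rw [hsplit]
      calc ‖A * (A ^ (m + 1) - B ^ (m + 1)) + (A - B) * B ^ (m + 1)‖
          ≤ ‖A‖ * ‖A ^ (m + 1) - B ^ (m + 1)‖ + ‖A - B‖ * ‖B ^ (m + 1)‖ :=
            (norm_add_le _ _).trans (add_le_add (norm_mul_le _ _) (norm_mul_le _ _))
        _ ≤ 1 * ((m + 1) * 2 ^ m * η) + η * 2 ^ (m + 1) := by
            gcongr
            exact hBpow m
        _ ≤ ((m + 1 : ℕ) + 1) * 2 ^ (m + 1) * η := by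
            push_cast
            have : 0 ≤ (m + 1 : ℝ) * 2 ^ m * η := by positivity
            rw [pow_succ]; nlinarith
  -- Cauchy-Schwarz bounds the trace of a product of two matrices, so one factor is split off each
  -- power; this is why the exponent is at least 2.
  rw [← Matrix.trace_sub, hsplit, Matrix.trace_add]
  calc ‖(A * (A ^ (m + 1) - B ^ (m + 1))).trace + ((A - B) * B ^ (m + 1)).trace‖
      ≤ ‖A‖ * ‖A ^ (m + 1) - B ^ (m + 1)‖ + ‖A - B‖ * ‖B ^ (m + 1)‖ :=
        (norm_add_le _ _).trans (add_le_add (norm_trace_mul_le _ _) (norm_trace_mul_le _ _))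
    _ ≤ 1 * ((m + 1) * 2 ^ m * η) + η * 2 ^ (m + 1) := by
        gcongr
        · exact hdiff m
        · exact hBpow m
    _ ≤ (m + 2) * 2 ^ (m + 1) * η := by
        have : 0 ≤ (m + 1 : ℝ) * 2 ^ m * η := by positivity
        rw [pow_succ]; nlinarith

end Frobenius

section Eigenvalues

theorem trace_pow_eq_sum_eigenvalues {ι : Type*} [Fintype ι] [DecidableEq ι] {A : Matrix ι ι ℝ}
    (hA : A.IsHermitian) (m : ℕ) : (A ^ m).trace = ∑ i, hA.eigenvalues i ^ m := by
  conv_lhs => rw [hA.spectral_theorem, ← map_pow, Unitary.conjStarAlgAut_apply,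
    Matrix.trace_mul_comm, ← mul_assoc]
  simp [Matrix.diagonal_pow, Matrix.trace]

end Eigenvalues

/-! ### From moments to measures of sets away from the origin -/

section Moments

/-- Normalizing reduces this to the portmanteau theorem for probability measures. A zero limit
cannot be normalized, but there the total masses already tend to zero. -/
theorem FiniteMeasure.tendsto_measure_of_null_frontier {κs : ℕ → FiniteMeasure ℝ}
    {κ : FiniteMeasure ℝ} (h : Tendsto κs atTop (𝓝 κ)) {B : Set ℝ}
    (hB : (κ : Measure ℝ) (frontier B) = 0) :
    Tendsto (fun N => (κs N : Measure ℝ) B) atTop (𝓝 ((κ : Measure ℝ) B)) := by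
  suffices hnn : Tendsto (fun N => κs N B) atTop (𝓝 (κ B)) by
    have := ENNReal.tendsto_coe.2 hnn
    simpa only [FiniteMeasure.ennreal_coeFn_eq_coeFn_toMeasure] using this
  have hmass := h.mass
  rcases eq_or_ne κ 0 with rfl | h0
  · simp only [FiniteMeasure.zero_mass] at hmass
    simp only [FiniteMeasure.coeFn_zero, Pi.zero_apply]
    exact tendsto_of_tendsto_of_tendsto_of_le_of_le tendsto_const_nhds hmass
      (fun _ => zero_le) fun N => (κs N).apply_le_mass B
  · have hnorm := FiniteMeasure.tendsto_normalize_of_tendsto h h0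
    have hB' : κ.normalize (frontier B) = 0 := by
      rw [κ.normalize_eq_of_nonzero h0, (FiniteMeasure.null_iff_toMeasure_null κ _).2 hB, mul_zero]
    have := hmass.mul
      (ProbabilityMeasure.tendsto_measure_of_null_frontier_of_tendsto hnorm hB')
    simp only [← FiniteMeasure.self_eq_mass_mul_normalize] at this
    exact this

/-- If the moments from the fourth on of measures on `[-1, 1]` converge, then so do the
integrals of all continuous functions with a fourth-order zero at the origin. -/
theorem tendsto_integral_mul_pow_four {μs : ℕ → Measure ℝ} {μ : Measure ℝ}
    (hs : ∀ N, ∀ᵐ x ∂μs N, x ∈ Set.Icc (-1 : ℝ) 1) (hs' : ∀ᵐ x ∂μ, x ∈ Set.Icc (-1 : ℝ) 1)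
    (hi : ∀ N, Integrable (fun x : ℝ => x ^ 4) (μs N)) (hi' : Integrable (fun x : ℝ => x ^ 4) μ)
    (hmom : ∀ m : ℕ, Tendsto (fun N => ∫ x, x ^ m * x ^ 4 ∂μs N) atTop
      (𝓝 (∫ x, x ^ m * x ^ 4 ∂μ))) {f : ℝ → ℝ} (hf : Continuous f) :
    Tendsto (fun N => ∫ x, f x * x ^ 4 ∂μs N) atTop (𝓝 (∫ x, f x * x ^ 4 ∂μ)) := by
  have hint : ∀ {ν : Measure ℝ}, (∀ᵐ x ∂ν, x ∈ Set.Icc (-1 : ℝ) 1) →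
      Integrable (fun x : ℝ => x ^ 4) ν → ∀ {g : ℝ → ℝ}, Continuous g →
      Integrable (fun x => g x * x ^ 4) ν := fun {ν} h1 h2 {g} hg => by
    obtain ⟨C, hC⟩ := isCompact_Icc.exists_bound_of_continuousOn (s := Set.Icc (-1 : ℝ) 1)
      hg.continuousOn
    refine h2.bdd_mul (c := C) hg.aestronglyMeasurable ?_
    filter_upwards [h1] with x hx using hC x hx
  have hpoly : ∀ p : Polynomial ℝ, Tendsto (fun N => ∫ x, p.eval x * x ^ 4 ∂μs N) atTop
      (𝓝 (∫ x, p.eval x * x ^ 4 ∂μ)) := fun p => by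
    induction p using Polynomial.induction_on' with
    | add p q hp hq =>
      have hadd : ∀ {ν : Measure ℝ}, (∀ᵐ x ∂ν, x ∈ Set.Icc (-1 : ℝ) 1) →
          Integrable (fun x : ℝ => x ^ 4) ν → ∫ x, (p + q).eval x * x ^ 4 ∂ν =
          ∫ x, p.eval x * x ^ 4 ∂ν + ∫ x, q.eval x * x ^ 4 ∂ν := fun {ν} h1 h2 => by
        rw [← integral_add (hint h1 h2 p.continuous) (hint h1 h2 q.continuous)]
        simp [add_mul]
      rw [hadd hs' hi']
      simp_rw [fun N => hadd (hs N) (hi N)]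
      exact hp.add hq
    | monomial m a =>
      have hmon : ∀ ν : Measure ℝ, ∫ x, (Polynomial.monomial m a).eval x * x ^ 4 ∂ν =
          a * ∫ x, x ^ m * x ^ 4 ∂ν := fun ν => by
        rw [← integral_const_mul]
        simp [Polynomial.eval_monomial, mul_assoc]
      simp_rw [hmon]
      exact (hmom m).const_mul a
  set A := ∫ x, x ^ 4 ∂μ with hA
  have hAN : Tendsto (fun N => ∫ x, x ^ 4 ∂μs N) atTop (𝓝 A) := by simpa using hmom 0
  have hA0 : 0 ≤ A := integral_nonneg fun x => by positivity
  have hclose : ∀ {ν : Measure ℝ}, (∀ᵐ x ∂ν, x ∈ Set.Icc (-1 : ℝ) 1) →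
      Integrable (fun x : ℝ => x ^ 4) ν → ∀ (p : Polynomial ℝ) (e : ℝ),
      (∀ x ∈ Set.Icc (-1 : ℝ) 1, |p.eval x - f x| < e) →
      |∫ x, f x * x ^ 4 ∂ν - ∫ x, p.eval x * x ^ 4 ∂ν| ≤ e * ∫ x, x ^ 4 ∂ν :=
    fun {ν} h1 h2 p e hp => by
      rw [← integral_sub (hint h1 h2 hf) (hint h1 h2 p.continuous), ← integral_const_mul,
        ← Real.norm_eq_abs]
      refine norm_integral_le_of_norm_le (h2.const_mul e) ?_
      filter_upwards [h1] with x hx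
      rw [← sub_mul, norm_mul, Real.norm_eq_abs, abs_sub_comm,
        Real.norm_of_nonneg (by positivity : (0 : ℝ) ≤ x ^ 4)]
      exact mul_le_mul_of_nonneg_right (hp x hx).le (by positivity)
  rw [Metric.tendsto_atTop]
  intro ε hε
  -- The weights have mass below `A + 1` eventually, so replacing `f` by a polynomial within `e`
  -- costs at most `ε / 4` on each side.
  set e := ε / (4 * (A + 1)) with he
  have he0 : 0 < e := by positivity
  obtain ⟨p, hp⟩ := exists_polynomial_near_of_continuousOn (-1) 1 f hf.continuousOn e he0
  have h1 := (hAN.eventually_lt_const (lt_add_one A))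
  have h2 := Metric.tendsto_atTop.1 (hpoly p) (ε / 4) (by positivity)
  obtain ⟨N2, hN2⟩ := h2
  obtain ⟨N1, hN1⟩ := eventually_atTop.1 h1
  refine ⟨max N1 N2, fun N hN => ?_⟩
  have c1 := hclose (hs N) (hi N) p e hp
  have c2 := hclose hs' hi' p e hp
  have c3 := hN2 N ((le_max_right _ _).trans hN)
  have c4 := hN1 N ((le_max_left _ _).trans hN)
  rw [Real.dist_eq] at c3 ⊢
  have e1 : e * (A + 1) = ε / 4 := by rw [he]; field_simp
  have c5 : e * ∫ x, x ^ 4 ∂μs N ≤ ε / 4 := by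
    rw [← e1]; exact mul_le_mul_of_nonneg_left c4.le he0.le
  have c6 : e * A ≤ ε / 4 := by
    rw [← e1]; exact mul_le_mul_of_nonneg_left (by linarith) he0.le
  rw [abs_le] at c1 c2
  rw [abs_lt] at c3 ⊢
  constructor <;> linarith [c1.1, c1.2, c2.1, c2.2, c3.1, c3.2]

/-- Convergence of the moments from the fourth on implies the convergence of the measures of all
sets that have a null boundary and stay away from the origin. -/
theorem tendsto_measure_of_tendsto_moments {μs : ℕ → Measure ℝ} {μ : Measure ℝ}
    (hs : ∀ N, ∀ᵐ x ∂μs N, x ∈ Set.Icc (-1 : ℝ) 1) (hs' : ∀ᵐ x ∂μ, x ∈ Set.Icc (-1 : ℝ) 1)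
    (hi : ∀ N, Integrable (fun x : ℝ => x ^ 4) (μs N)) (hi' : Integrable (fun x : ℝ => x ^ 4) μ)
    (hmom : ∀ m : ℕ, Tendsto (fun N => ∫ x, x ^ m * x ^ 4 ∂μs N) atTop
      (𝓝 (∫ x, x ^ m * x ^ 4 ∂μ))) {B : Set ℝ} (hBm : MeasurableSet B)
    (hB : μ (frontier B) = 0) (h0 : (0 : ℝ) ∉ closure B) :
    Tendsto (fun N => μs N B) atTop (𝓝 (μ B)) := by
  obtain ⟨ε, hε, hεB⟩ := Metric.isOpen_iff.1 isClosed_closure.isOpen_compl 0 h0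
  have hBε : ∀ x ∈ B, ε ≤ |x| := fun x hx => by
    by_contra hcon
    refine hεB (a := x) ?_ (subset_closure hx)
    simpa using hcon
  -- A continuous bounded truncation of `x ^ (-4)`, exact on `B`. The density `g x * x ^ 4` then
  -- gives finite measures that agree with the original ones on `B`.
  set g : ℝ → ℝ := fun x => (max (x ^ 4) (ε ^ 4))⁻¹ with hg
  have hmax : ∀ x : ℝ, 0 < max (x ^ 4) (ε ^ 4) := fun x => lt_max_of_lt_right (by positivity)
  have hgc : Continuous g := by
    refine Continuous.inv₀ (by fun_prop) fun x => (hmax x).ne'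
  have hg0 : ∀ x, 0 ≤ g x := fun x => (inv_pos.2 (hmax x)).le
  have hgle : ∀ x, g x ≤ (ε ^ 4)⁻¹ := fun x => inv_anti₀ (by positivity) (le_max_right _ _)
  set h : ℝ → ℝ := fun x => g x * x ^ 4 with hh
  have hhc : Continuous h := hgc.mul (continuous_pow 4)
  have hh0 : ∀ x, 0 ≤ h x := fun x => mul_nonneg (hg0 x) (by positivity)
  have hh1 : ∀ x ∈ B, h x = 1 := fun x hx => by
    have : ε ^ 4 ≤ x ^ 4 := by
      rw [← (by decide : Even 4).pow_abs x]
      exact pow_le_pow_left₀ hε.le (hBε x hx) 4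
    have hx4 : 0 < x ^ 4 := lt_of_lt_of_le (by positivity) this
    simp only [hh, hg, max_eq_left this]
    exact inv_mul_cancel₀ hx4.ne'
  have hhi : ∀ {ν : Measure ℝ}, Integrable (fun x : ℝ => x ^ 4) ν → Integrable h ν :=
    fun {ν} hν => hν.bdd_mul (c := (ε ^ 4)⁻¹) hgc.aestronglyMeasurable
      (Eventually.of_forall fun x => by
        rw [Real.norm_of_nonneg (hg0 x)]; exact hgle x)
  have hfin : ∀ {ν : Measure ℝ}, Integrable (fun x : ℝ => x ^ 4) ν →
      IsFiniteMeasure (ν.withDensity fun x => ENNReal.ofReal (h x)) := fun {ν} hν =>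
    isFiniteMeasure_withDensity_ofReal (hhi hν).2
  let κs : ℕ → FiniteMeasure ℝ := fun N => ⟨_, hfin (hi N)⟩
  let κ : FiniteMeasure ℝ := ⟨_, hfin hi'⟩
  have hmeas : Measurable fun x => ENNReal.ofReal (h x) := hhc.measurable.ennreal_ofReal
  have hintκ : ∀ (ν : Measure ℝ) (f : ℝ → ℝ),
      ∫ x, f x ∂(ν.withDensity fun x => ENNReal.ofReal (h x)) = ∫ x, (f x * g x) * x ^ 4 ∂ν :=
    fun ν f => by
      rw [integral_withDensity_eq_integral_toReal_smul hmeas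
        (Eventually.of_forall fun x => ENNReal.ofReal_lt_top)]
      congr 1; ext x
      rw [ENNReal.toReal_ofReal (hh0 x), smul_eq_mul, hh]
      ring
  have hκ : Tendsto κs atTop (𝓝 κ) := by
    rw [FiniteMeasure.tendsto_iff_forall_integral_tendsto]
    intro f
    have := tendsto_integral_mul_pow_four hs hs' hi hi' hmom (f := fun x => f x * g x)
      (f.continuous.mul hgc)
    simpa only [κs, κ, FiniteMeasure.toMeasure_mk, hintκ] using this
  have hBκ : (κ : Measure ℝ) (frontier B) = 0 :=
    withDensity_absolutelyContinuous _ _ hB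
  have heq : ∀ ν : Measure ℝ, (ν.withDensity fun x => ENNReal.ofReal (h x)) B = ν B := fun ν => by
    rw [withDensity_apply _ hBm, setLIntegral_congr_fun (g := fun _ => 1) hBm fun x hx => by
      simp [hh1 x hx]]
    simp
  have := FiniteMeasure.tendsto_measure_of_null_frontier hκ hBκ
  simpa only [κs, κ, FiniteMeasure.toMeasure_mk, heq] using this

end Moments

/-! ### Characters of the torus and mean-square Fourier approximation -/

section Fourier

variable {d : ℕ}

instance : IsProbabilityMeasure (torusMeasure d) := by unfold torusMeasure; infer_instance

instance : (torusMeasure d).IsAddLeftInvariant := by unfold torusMeasure; infer_instance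

instance : (torusMeasure d).IsNegInvariant := by
  have : (AddCircle.haarAddCircle : Measure UnitAddCircle).IsNegInvariant :=
    Measure.IsAddHaarMeasure.isNegInvariant_of_innerRegular _
  unfold torusMeasure; infer_instance

theorem norm_mFourier_apply (z : Fin d → ℤ) (x : UnitAddTorus (Fin d)) :
    ‖UnitAddTorus.mFourier z x‖ = 1 := by
  simp [UnitAddTorus.mFourier, norm_prod, Circle.norm_coe]

theorem mFourier_add_apply (z : Fin d → ℤ) (x y : UnitAddTorus (Fin d)) :
    UnitAddTorus.mFourier z (x + y) = UnitAddTorus.mFourier z x * UnitAddTorus.mFourier z y := by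
  simp [UnitAddTorus.mFourier, ← Finset.prod_mul_distrib, fourier_apply, smul_add,
    AddCircle.toCircle_add]

theorem mFourier_neg_apply (z : Fin d → ℤ) (x : UnitAddTorus (Fin d)) :
    UnitAddTorus.mFourier z (-x) = (starRingEnd ℂ) (UnitAddTorus.mFourier z x) := by
  rw [← UnitAddTorus.mFourier_neg]
  simp [UnitAddTorus.mFourier]

theorem mFourier_sub_apply (z : Fin d → ℤ) (x y : UnitAddTorus (Fin d)) :
    UnitAddTorus.mFourier z (x - y) =
      UnitAddTorus.mFourier z x * (starRingEnd ℂ) (UnitAddTorus.mFourier z y) := by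
  rw [sub_eq_add_neg, mFourier_add_apply, mFourier_neg_apply]

theorem integral_mFourier {z : Fin d → ℤ} (hz : z ≠ 0) :
    ∫ x, UnitAddTorus.mFourier z x ∂(torusMeasure d) = 0 := by
  have h := orthonormal_iff_ite.1 (UnitAddTorus.orthonormal_mFourier (d := Fin d)) 0 z
  rw [if_neg hz.symm, ContinuousMap.inner_toLp] at h
  simpa [UnitAddTorus.mFourier_zero] using! h

/-- The trigonometric polynomial with coefficients `c` and frequencies in `S`. -/
def trigPoly (S : Finset (Fin d → ℤ)) (c : (Fin d → ℤ) → ℂ) (x : UnitAddTorus (Fin d)) : ℂ :=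
  ∑ z ∈ S, c z * UnitAddTorus.mFourier z x

theorem continuous_trigPoly (S : Finset (Fin d → ℤ)) (c : (Fin d → ℤ) → ℂ) :
    Continuous (trigPoly S c) := by
  unfold trigPoly; fun_prop

theorem norm_trigPoly_le (S : Finset (Fin d → ℤ)) (c : (Fin d → ℤ) → ℂ)
    (x : UnitAddTorus (Fin d)) : ‖trigPoly S c x‖ ≤ ∑ z ∈ S, ‖c z‖ := by
  refine (norm_sum_le _ _).trans (Finset.sum_le_sum fun z _ => ?_)
  rw [norm_mul, norm_mFourier_apply, mul_one]

variable {φ : UnitAddTorus (Fin d) → ℝ}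

theorem memLp_torus (hφm : Measurable φ) (hφ : ∀ x, φ x ∈ Set.Icc (0 : ℝ) 1) :
    MemLp (fun x => (φ x : ℂ)) 2 (torusMeasure d) := by
  refine MemLp.of_bound (Complex.measurable_ofReal.comp hφm).aestronglyMeasurable 1
    (Eventually.of_forall fun x => ?_)
  rw [Complex.norm_real, Real.norm_of_nonneg (hφ x).1]
  exact (hφ x).2

theorem norm_fourierCoef_le (hφ : ∀ x, φ x ∈ Set.Icc (0 : ℝ) 1) (z : Fin d → ℤ) :
    ‖fourierCoef φ z‖ ≤ 1 := by
  have := norm_integral_le_of_norm_le_const (μ := torusMeasure d)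
    (f := fun x => UnitAddTorus.mFourier (-z) x * (φ x : ℂ)) (C := 1)
    (Eventually.of_forall fun x => by
      rw [norm_mul, norm_mFourier_apply, one_mul, Complex.norm_real, Real.norm_of_nonneg (hφ x).1]
      exact (hφ x).2)
  simpa [fourierCoef] using this

theorem mFourierCoeff_toLp_eq (hφm : Measurable φ) (hφ : ∀ x, φ x ∈ Set.Icc (0 : ℝ) 1)
    (z : Fin d → ℤ) :
    UnitAddTorus.mFourierCoeff ((memLp_torus hφm hφ).toLp (fun x => (φ x : ℂ))) z =
      fourierCoef φ z := by
  unfold fourierCoef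
  refine integral_congr_ae ?_
  filter_upwards [(memLp_torus hφm hφ).coeFn_toLp] with x hx
  rw [hx, smul_eq_mul]

theorem summable_sq_fourierCoef (hφm : Measurable φ) (hφ : ∀ x, φ x ∈ Set.Icc (0 : ℝ) 1) :
    Summable fun z => ‖fourierCoef φ z‖ ^ 2 := by
  have h := (UnitAddTorus.hasSum_sq_mFourierCoeff
    ((memLp_torus hφm hφ).toLp (fun x => (φ x : ℂ)))).summable
  exact h.congr fun z => congrArg (fun c : ℂ => ‖c‖ ^ 2) (mFourierCoeff_toLp_eq hφm hφ z)

/-- The partial sums of the Fourier series converge in mean square. -/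
theorem tendsto_integral_sq_sub_trigPoly (hφm : Measurable φ)
    (hφ : ∀ x, φ x ∈ Set.Icc (0 : ℝ) 1) :
    Tendsto (fun S : Finset (Fin d → ℤ) =>
      ∫ x, ‖(φ x : ℂ) - trigPoly S (fourierCoef φ) x‖ ^ 2 ∂(torusMeasure d)) atTop (𝓝 0) := by
  let f : Lp ℂ 2 (torusMeasure d) := (memLp_torus hφm hφ).toLp (fun x => (φ x : ℂ))
  let g : Finset (Fin d → ℤ) → Lp ℂ 2 (torusMeasure d) := fun S =>
    ContinuousMap.toLp (E := ℂ) 2 (torusMeasure d) ℂ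
      (∑ z ∈ S, fourierCoef φ z • UnitAddTorus.mFourier z)
  have h : Tendsto g atTop (𝓝 f) := by
    have h1 : HasSum (fun z => fourierCoef φ z •
        ContinuousMap.toLp (E := ℂ) 2 (torusMeasure d) ℂ (UnitAddTorus.mFourier z)) f := by
      have h0 := UnitAddTorus.hasSum_mFourier_series_L2 f
      exact h0.congr_fun fun z => congrArg (fun c : ℂ => c •
        ContinuousMap.toLp (E := ℂ) 2 (torusMeasure d) ℂ (UnitAddTorus.mFourier z))
        (mFourierCoeff_toLp_eq hφm hφ z).symm
    refine Tendsto.congr (fun S => ?_) h1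
    simp only [g, map_sum, map_smul]
  have h2 := ((tendsto_const_nhds (x := f)).sub h).norm.pow 2
  rw [sub_self, norm_zero, zero_pow two_ne_zero] at h2
  refine h2.congr fun S => ?_
  have hae : ((f - g S : Lp ℂ 2 (torusMeasure d)) : UnitAddTorus (Fin d) → ℂ) =ᵐ[torusMeasure d]
      fun x => (φ x : ℂ) - trigPoly S (fourierCoef φ) x := by
    filter_upwards [Lp.coeFn_sub f (g S), (memLp_torus hφm hφ).coeFn_toLp,
      ContinuousMap.coeFn_toLp (p := 2) (𝕜 := ℂ) (torusMeasure d)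
        (∑ z ∈ S, fourierCoef φ z • UnitAddTorus.mFourier z)] with x h1 h2 h3
    rw [h1, Pi.sub_apply, h2, h3]
    simp [trigPoly]
  rw [← inner_self_eq_norm_sq (𝕜 := ℂ), L2.inner_def, ← integral_re (L2.integrable_inner _ _)]
  simp only [inner_self_eq_norm_sq]
  refine integral_congr_ae ?_
  filter_upwards [hae] with x hx
  rw [hx]

end Fourier

/-! ### Powers of two-valued block matrices -/

section BlockMatrices

/-- The `k × k` matrix with `α` on the diagonal and `β` elsewhere. -/
def blockMat (k : ℕ) (α β : ℂ) : Matrix (Fin k) (Fin k) ℂ :=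
  Matrix.of fun a b => if a = b then α else β

/-- With `J` the all-ones matrix, these matrices are `β J + r`, and `J * J = k J` closes the family
under products. -/
theorem blockMat_mul (k : ℕ) (β r β' r' : ℂ) :
    blockMat k (β + r) β * blockMat k (β' + r') β' =
      blockMat k ((k * β * β' + β * r' + r * β') + r * r') (k * β * β' + β * r' + r * β') := by
  have h : ∀ (β r : ℂ) (a b : Fin k), blockMat k (β + r) β a b = β + if a = b then r else 0 :=
    fun β r a b => by
      simp only [blockMat, Matrix.of_apply]
      split_ifs <;> ring
  ext a b
  rw [h, Matrix.mul_apply]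
  simp only [h, add_mul, mul_add, Finset.sum_add_distrib]
  simp only [mul_ite, ite_mul, mul_zero, zero_mul, Finset.sum_const, Finset.sum_ite_eq,
    Finset.sum_ite_eq', Finset.mem_univ, if_true, Finset.card_univ, Fintype.card_fin,
    nsmul_eq_mul]
  split_ifs <;> ring

theorem trace_blockMat_pow (k : ℕ) (α β : ℂ) (m : ℕ) :
    (blockMat k α β ^ m).trace = (α + (k - 1) * β) ^ m + (k - 1) * (α - β) ^ m := by
  -- The power is `q J + r`: here `r` is the eigenvalue on vectors of sum zero, and `k * q + r` the
  -- eigenvalue on constant vectors.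
  obtain ⟨q, r, hpow, hr, hq⟩ : ∃ q r : ℂ, blockMat k α β ^ m = blockMat k (q + r) q ∧
      r = (α - β) ^ m ∧ k * q + r = (α + (k - 1) * β) ^ m := by
    induction m with
    | zero =>
      refine ⟨0, 1, ?_, by simp, by simp⟩
      ext a b
      simp [blockMat, Matrix.one_apply]
    | succ m ih =>
      obtain ⟨q, r, hpow, hr, hq⟩ := ih
      have hα : blockMat k α β = blockMat k (β + (α - β)) β := by rw [add_sub_cancel]
      refine ⟨k * q * β + q * (α - β) + r * β, r * (α - β), ?_, ?_, ?_⟩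
      · rw [pow_succ, hpow, hα, blockMat_mul]
      · rw [pow_succ, hr]
      · rw [pow_succ, ← hq]; ring
  rw [hpow, ← hq, ← hr]
  simp only [blockMat, Matrix.trace, Matrix.diag, Matrix.of_apply, if_true, Finset.sum_const,
    Finset.card_univ, Fintype.card_fin, nsmul_eq_mul]
  ring

theorem trace_mul_pow_comm {ι κ R : Type*} [Fintype ι] [DecidableEq ι] [Fintype κ] [DecidableEq κ]
    [CommRing R] (A : Matrix ι κ R) (B : Matrix κ ι R) (m : ℕ) :
    ((A * B) ^ (m + 1)).trace = ((B * A) ^ (m + 1)).trace := by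
  have h : (A * B) ^ (m + 1) = A * ((B * A) ^ m * B) := by
    induction m with
    | zero => simp
    | succ m ih =>
      rw [pow_succ', ih, pow_succ']
      simp only [Matrix.mul_assoc]
  rw [h, Matrix.trace_mul_comm, Matrix.mul_assoc, pow_succ]

end BlockMatrices

/-! ### Spectral moments of trigonometric block models -/

section TrigMatrices

variable {d k n : ℕ}

/-- The matrix of a block model whose connection functions are trigonometric polynomials. -/
def trigMatrix (S : Finset (Fin d → ℤ)) (c c' : (Fin d → ℤ) → ℂ) (σ : Fin n → Fin k)
    (x : Fin n → UnitAddTorus (Fin d)) : Matrix (Fin n) (Fin n) ℂ :=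
  Matrix.of fun i j =>
    if σ i = σ j then trigPoly S c (x i - x j) else trigPoly S c' (x i - x j)

/-- The matrix of the monomials at the positions of each community. -/
def monomialMatrix (S : Finset (Fin d → ℤ)) (σ : Fin n → Fin k)
    (x : Fin n → UnitAddTorus (Fin d)) : Matrix (Fin n) (Fin k × S) ℂ :=
  Matrix.of fun i p => if σ i = p.1 then UnitAddTorus.mFourier p.2.1 (x i) else 0

/-- A character at `x i - x j` splits into a factor at `x i` and a conjugate factor at `x j`, so the
rank is bounded independently of `n`. -/
theorem trigMatrix_eq (S : Finset (Fin d → ℤ)) (c c' : (Fin d → ℤ) → ℂ) (σ : Fin n → Fin k)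
    (x : Fin n → UnitAddTorus (Fin d)) :
    trigMatrix S c c' σ x = monomialMatrix S σ x *
      (Matrix.blockDiagonal (fun z : S => blockMat k (c z) (c' z)) *
        (monomialMatrix S σ x).conjTranspose) := by
  ext i j
  have h1 : ∀ (a : Fin k) (z : S),
      (Matrix.blockDiagonal (fun z : S => blockMat k (c z) (c' z)) *
        (monomialMatrix S σ x).conjTranspose) (a, z) j =
      blockMat k (c z) (c' z) a (σ j) * (starRingEnd ℂ) (UnitAddTorus.mFourier z.1 (x j)) :=
    fun a z => by
      rw [Matrix.mul_apply, Fintype.sum_prod_type, Finset.sum_eq_single (σ j),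
        Finset.sum_eq_single z]
      · simp [monomialMatrix, Matrix.blockDiagonal_apply]
      · intro z' _ hz'
        simp [Matrix.blockDiagonal_apply, hz'.symm]
      · simp
      · intro b _ hb
        simp [monomialMatrix, hb.symm]
      · simp
  rw [Matrix.mul_apply, Fintype.sum_prod_type, Finset.sum_eq_single (σ i)]
  · simp only [h1]
    simp only [monomialMatrix, Matrix.of_apply, if_true, blockMat, trigMatrix, trigPoly,
      mFourier_sub_apply]
    split_ifs
    · rw [← Finset.sum_coe_sort S]
      exact Finset.sum_congr rfl fun z _ => by ring
    · rw [← Finset.sum_coe_sort S]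
      exact Finset.sum_congr rfl fun z _ => by ring
  · intro a _ ha
    simp [monomialMatrix, ha.symm]
  · simp

/-- Columns of different communities have disjoint supports. Within a community, conjugation
subtracts frequencies, so every entry off the diagonal is an exponential sum with nonzero frequency
or zero. -/
theorem gram_monomialMatrix (S : Finset (Fin d → ℤ)) (σ : Fin n → Fin k)
    (x : Fin n → UnitAddTorus (Fin d)) (p q : Fin k × S) :
    ((monomialMatrix S σ x).conjTranspose * monomialMatrix S σ x) p q =
      if p.1 = q.1 then ∑ i, if σ i = p.1 then
        UnitAddTorus.mFourier (q.2.1 - p.2.1) (x i) else 0 else 0 := by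
  rw [Matrix.mul_apply]
  simp only [Matrix.conjTranspose_apply, monomialMatrix, Matrix.of_apply]
  split_ifs with hpq
  · refine Finset.sum_congr rfl fun i _ => ?_
    rw [← hpq]
    split_ifs
    · rw [sub_eq_add_neg, UnitAddTorus.mFourier_add, UnitAddTorus.mFourier_neg, mul_comm]
      rfl
    · simp
  · refine Finset.sum_eq_zero fun i _ => ?_
    by_cases h : σ i = p.1
    · rw [if_neg (h ▸ hpq : σ i ≠ q.1), mul_zero]
    · rw [if_neg h, star_zero, zero_mul]

/-- Traces of powers of block matrices of trigonometric polynomials at equidistributed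
positions. -/
theorem tendsto_trace_trigMatrix_pow (hk : 0 < k) (S : Finset (Fin d → ℤ))
    (c c' : (Fin d → ℤ) → ℂ) {σ : ∀ N : ℕ, Fin (k * N) → Fin k}
    (hσ : ∀ (N : ℕ) (q : Fin k), (Finset.univ.filter fun i => σ N i = q).card = N)
    (x : ∀ N : ℕ, Fin (k * N) → UnitAddTorus (Fin d))
    (hx : ∀ z : Fin d → ℤ, z ≠ 0 → ∀ a : Fin k, Tendsto (fun N : ℕ =>
      ((k * N : ℕ) : ℂ)⁻¹ * ∑ i, if σ N i = a then UnitAddTorus.mFourier z (x N i) else 0)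
      atTop (𝓝 0)) (m : ℕ) :
    Tendsto (fun N : ℕ =>
      (((((k * N : ℕ) : ℂ)⁻¹) • trigMatrix S c c' (σ N) (x N)) ^ (m + 1)).trace) atTop
      (𝓝 (∑ z ∈ S, (((c z + (k - 1) * c' z) / k) ^ (m + 1)
        + (k - 1) * ((c z - c' z) / k) ^ (m + 1)))) := by
  have hk' : (k : ℂ) ≠ 0 := by exact_mod_cast hk.ne'
  set C : Matrix (Fin k × S) (Fin k × S) ℂ :=
    Matrix.blockDiagonal (fun z : S => blockMat k (c z) (c' z)) with hC
  let Γ : ∀ N : ℕ, Matrix (Fin k × S) (Fin k × S) ℂ := fun N => (((k * N : ℕ) : ℂ)⁻¹) •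
    ((monomialMatrix S (σ N) (x N)).conjTranspose * monomialMatrix S (σ N) (x N))
  have hΓ : Tendsto Γ atTop (𝓝 ((k : ℂ)⁻¹ • (1 : Matrix (Fin k × S) (Fin k × S) ℂ))) := by
    refine tendsto_pi_nhds.2 fun p => tendsto_pi_nhds.2 fun q => ?_
    simp only [Γ, Matrix.smul_apply, gram_monomialMatrix, smul_eq_mul]
    by_cases h1 : p.1 = q.1
    · simp only [if_pos h1]
      by_cases h2 : p.2 = q.2
      · have hpq : p = q := Prod.ext h1 h2
        subst hpq
        refine tendsto_const_nhds.congr' ?_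
        filter_upwards [eventually_gt_atTop 0] with N hN
        have hN' : (N : ℂ) ≠ 0 := by exact_mod_cast hN.ne'
        simp only [sub_self, UnitAddTorus.mFourier_zero, ContinuousMap.one_apply,
          Matrix.one_apply_eq, mul_one]
        rw [← Finset.sum_filter, Finset.sum_const, hσ N, nsmul_eq_mul, mul_one]
        push_cast
        field_simp
      · have hne : p ≠ q := fun h => h2 (h ▸ rfl)
        rw [Matrix.one_apply_ne hne, mul_zero]
        exact hx _ (fun h => h2 (Subtype.ext (sub_eq_zero.1 h).symm)) _
    · have hne : p ≠ q := fun h => h1 (h ▸ rfl)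
      simp only [if_neg h1, mul_zero, Matrix.one_apply_ne hne]
      exact tendsto_const_nhds
  -- The index set `Fin k × S` does not grow with `N`, so entrywise convergence of the Gram matrices
  -- suffices.
  have hcont : Continuous fun Q : Matrix (Fin k × S) (Fin k × S) ℂ =>
      ((C * Q) ^ (m + 1)).trace := by fun_prop
  have hlim := (hcont.tendsto _).comp hΓ
  have hval : ((C * ((k : ℂ)⁻¹ • (1 : Matrix (Fin k × S) (Fin k × S) ℂ))) ^ (m + 1)).trace =
      ∑ z ∈ S, (((c z + (k - 1) * c' z) / k) ^ (m + 1)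
        + (k - 1) * ((c z - c' z) / k) ^ (m + 1)) := by
    rw [Matrix.mul_smul, Matrix.mul_one, smul_pow, Matrix.trace_smul, hC,
      ← Matrix.blockDiagonal_pow, Matrix.trace_blockDiagonal, ← Finset.sum_coe_sort S,
      smul_eq_mul, Finset.mul_sum]
    refine Finset.sum_congr rfl fun z _ => ?_
    rw [Pi.pow_apply, trace_blockMat_pow, div_pow, div_pow, inv_pow]
    field_simp
  rw [hval] at hlim
  refine hlim.congr fun N => ?_
  simp only [Function.comp_apply, Γ]
  have hfac : (((k * N : ℕ) : ℂ)⁻¹) • trigMatrix S c c' (σ N) (x N) =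
      monomialMatrix S (σ N) (x N) *
        (C * ((((k * N : ℕ) : ℂ)⁻¹) • (monomialMatrix S (σ N) (x N)).conjTranspose)) := by
    rw [trigMatrix_eq, ← hC, Matrix.mul_smul, Matrix.mul_smul]
  rw [hfac]
  refine Eq.trans ?_ (trace_mul_pow_comm (monomialMatrix S (σ N) (x N)) _ m).symm
  rw [Matrix.mul_assoc, Matrix.smul_mul]

end TrigMatrices

/-! ### Hilbert-Schmidt error of the Fourier approximation -/

section Approximation

variable {d k n : ℕ} {F F' : UnitAddTorus (Fin d) → ℝ}

/-- The squared Hilbert-Schmidt distance between the matrix of connection probabilities and its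
trigonometric approximation. -/
theorem sum_norm_sq_connMatrix_sub_le (S : Finset (Fin d → ℤ)) (c c' : (Fin d → ℤ) → ℂ)
    (σ : Fin n → Fin k) (x : Fin n → UnitAddTorus (Fin d)) :
    ∑ i, ∑ j, ‖((((n : ℝ)⁻¹ • connMatrix (blockFun F F') σ x).map ((↑) : ℝ → ℂ)) -
      ((n : ℂ)⁻¹ • trigMatrix S c c' σ x)) i j‖ ^ 2 ≤
      (∑ p ∈ (Finset.univ : Finset (Fin n)).offDiag, (if σ p.1 = σ p.2 then
        ‖(F (x p.1 - x p.2) : ℂ) - trigPoly S c (x p.1 - x p.2)‖ ^ 2 else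
        ‖(F' (x p.1 - x p.2) : ℂ) - trigPoly S c' (x p.1 - x p.2)‖ ^ 2)) / (n : ℝ) ^ 2 +
      (∑ z ∈ S, ‖c z‖) ^ 2 * (n : ℝ)⁻¹ := by
  rcases Nat.eq_zero_or_pos n with rfl | hn
  · simp
  have hn' : (0 : ℝ) < n := by exact_mod_cast hn
  rw [← Fintype.sum_prod_type' (f := fun i j =>
    ‖((((n : ℝ)⁻¹ • connMatrix (blockFun F F') σ x).map ((↑) : ℝ → ℂ)) -
      ((n : ℂ)⁻¹ • trigMatrix S c c' σ x)) i j‖ ^ 2), ← Finset.univ_product_univ,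
    ← Finset.diag_union_offDiag, Finset.sum_union (Finset.disjoint_diag_offDiag _), add_comm]
  refine add_le_add ?_ ?_
  · rw [Finset.sum_div]
    refine Finset.sum_le_sum fun p hp => le_of_eq ?_
    have hp' : p.1 ≠ p.2 := by simpa using hp
    have hfac : ∀ u v : ℂ, ‖(n : ℂ)⁻¹ * u - (n : ℂ)⁻¹ * v‖ ^ 2 = ‖u - v‖ ^ 2 / (n : ℝ) ^ 2 :=
      fun u v => by
        rw [← mul_sub, norm_mul, mul_pow, norm_inv, Complex.norm_natCast, inv_pow, mul_comm]
        rfl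
    simp only [Matrix.sub_apply, Matrix.map_apply, Matrix.smul_apply, connMatrix, trigMatrix,
      Matrix.of_apply, if_neg hp', smul_eq_mul, blockFun, Complex.ofReal_mul, Complex.ofReal_inv,
      Complex.ofReal_natCast, hfac]
    split_ifs <;> rfl
  -- The connection matrix vanishes on the diagonal, so only the trigonometric matrix contributes:
  -- `n` entries of squared size `O(n ^ (-2))`.
  · have hb : ∀ p ∈ (Finset.univ : Finset (Fin n)).diag,
        ‖((((n : ℝ)⁻¹ • connMatrix (blockFun F F') σ x).map ((↑) : ℝ → ℂ)) -
          ((n : ℂ)⁻¹ • trigMatrix S c c' σ x)) p.1 p.2‖ ^ 2 ≤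
        ((n : ℝ)⁻¹ * ∑ z ∈ S, ‖c z‖) ^ 2 := fun p hp => by
      have hp' : p.1 = p.2 := by simpa using hp
      simp only [Matrix.sub_apply, Matrix.map_apply, Matrix.smul_apply, connMatrix, trigMatrix,
        Matrix.of_apply, hp', if_true, smul_eq_mul, mul_zero, Complex.ofReal_zero, zero_sub,
        norm_neg, norm_mul, norm_inv, Complex.norm_natCast]
      gcongr
      exact norm_trigPoly_le _ _ _
    refine (Finset.sum_le_card_nsmul _ _ _ hb).trans (le_of_eq ?_)
    rw [Finset.diag_card, Finset.card_univ, Fintype.card_fin, nsmul_eq_mul]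
    field_simp

/-- The mean square error of a trigonometric approximation. -/
def meanSqError (F : UnitAddTorus (Fin d) → ℝ) (S : Finset (Fin d → ℤ)) : ℝ :=
  ∫ x, ‖(F x : ℂ) - trigPoly S (fourierCoef F) x‖ ^ 2 ∂(torusMeasure d)

/-- The centred squared error of a trigonometric approximation. -/
def centredSqError (F : UnitAddTorus (Fin d) → ℝ) (S : Finset (Fin d → ℤ))
    (x : UnitAddTorus (Fin d)) : ℝ :=
  ‖(F x : ℂ) - trigPoly S (fourierCoef F) x‖ ^ 2 - meanSqError F S

theorem meanSqError_nonneg (S : Finset (Fin d → ℤ)) : 0 ≤ meanSqError F S :=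
  integral_nonneg fun _ => sq_nonneg _

/-- The law of large numbers replaces squared errors by their torus means. Adding both means for
every pair only overestimates, and the diagonal contributes `O(1 / n)`. -/
theorem eventually_sum_norm_sq_le (hk : 0 < k) (S : Finset (Fin d → ℤ))
    {σ : ∀ N : ℕ, Fin (k * N) → Fin k} (x : ∀ N : ℕ, Fin (k * N) → UnitAddTorus (Fin d))
    (hF : Tendsto (fun N : ℕ => (∑ p ∈ (Finset.univ : Finset (Fin (k * N))).offDiag,
      (if σ N p.1 = σ N p.2 then (1 : ℝ) else 0) * centredSqError F S (x N p.1 - x N p.2)) /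
        ((k * N : ℕ) : ℝ) ^ 2) atTop (𝓝 0))
    (hF' : Tendsto (fun N : ℕ => (∑ p ∈ (Finset.univ : Finset (Fin (k * N))).offDiag,
      (if σ N p.1 = σ N p.2 then (0 : ℝ) else 1) * centredSqError F' S (x N p.1 - x N p.2)) /
        ((k * N : ℕ) : ℝ) ^ 2) atTop (𝓝 0))
    {η : ℝ} (hη : meanSqError F S + meanSqError F' S < η ^ 2) :
    ∀ᶠ N : ℕ in atTop, ∑ i, ∑ j,
      ‖(((((k * N : ℕ) : ℝ)⁻¹ • connMatrix (blockFun F F') (σ N) (x N)).map ((↑) : ℝ → ℂ)) -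
      (((k * N : ℕ) : ℂ)⁻¹ • trigMatrix S (fourierCoef F) (fourierCoef F') (σ N) (x N))) i j‖ ^ 2
        ≤ η ^ 2 := by
  have hinv : Tendsto (fun N : ℕ => ((k * N : ℕ) : ℝ)⁻¹) atTop (𝓝 0) :=
    tendsto_inv_atTop_zero.comp (tendsto_natCast_atTop_atTop.comp
      (tendsto_id.const_mul_atTop' hk))
  have hlim := ((hF.add hF').add_const (meanSqError F S + meanSqError F' S)).add
    (hinv.const_mul ((∑ z ∈ S, ‖fourierCoef F z‖) ^ 2))
  simp only [zero_add, mul_zero, add_zero] at hlim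
  filter_upwards [hlim.eventually_lt_const hη, eventually_gt_atTop 0] with N hN hN0
  refine (sum_norm_sq_connMatrix_sub_le S _ _ (σ N) (x N)).trans (le_trans ?_ hN.le)
  have hn : (0 : ℝ) < ((k * N : ℕ) : ℝ) := by exact_mod_cast Nat.mul_pos hk hN0
  gcongr
  set n : ℝ := ((k * N : ℕ) : ℝ) with hndef
  have hr : meanSqError F S + meanSqError F' S =
      ((meanSqError F S + meanSqError F' S) * n ^ 2) / n ^ 2 := by field_simp
  rw [hr, ← add_div, ← add_div]
  gcongr
  have hcard : (((Finset.univ : Finset (Fin (k * N))).offDiag.card : ℕ) : ℝ) ≤ n ^ 2 := by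
    rw [Finset.offDiag_card, Finset.card_univ, Fintype.card_fin, hndef, sq]
    exact_mod_cast Nat.sub_le _ _
  have h0 : 0 ≤ meanSqError F S + meanSqError F' S :=
    add_nonneg (meanSqError_nonneg S) (meanSqError_nonneg S)
  refine le_trans ?_ (add_le_add_right (mul_le_mul_of_nonneg_left hcard h0) _)
  have hconst : (meanSqError F S + meanSqError F' S) *
      ((Finset.univ : Finset (Fin (k * N))).offDiag.card : ℝ) =
      ∑ _p ∈ (Finset.univ : Finset (Fin (k * N))).offDiag,
        (meanSqError F S + meanSqError F' S) := by
    rw [Finset.sum_const, nsmul_eq_mul, mul_comm]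
  rw [hconst, ← Finset.sum_add_distrib, ← Finset.sum_add_distrib]
  refine Finset.sum_le_sum fun p _ => ?_
  have h1 := meanSqError_nonneg (F := F) S
  have h2 := meanSqError_nonneg (F := F') S
  split_ifs
  · simp only [centredSqError]; linarith
  · simp only [centredSqError]; linarith

end Approximation

/-! ### Equidistribution of the positions within each community -/

section Equidistribution

variable {d k n : ℕ}

/-- The squared modulus of an exponential sum is a double sum over differences of positions, the
form covered by `ae_tendsto_sum_diff`; the diagonal gives at most `n`. -/
theorem norm_sq_sum_mFourier_le (z : Fin d → ℤ) (σ : Fin n → Fin k) (a : Fin k)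
    (x : Fin n → UnitAddTorus (Fin d)) :
    ‖∑ i, if σ i = a then UnitAddTorus.mFourier z (x i) else 0‖ ^ 2 ≤
      n + ∑ p ∈ (Finset.univ : Finset (Fin n)).offDiag,
        (if σ p.1 = a ∧ σ p.2 = a then (1 : ℝ) else 0) *
          (UnitAddTorus.mFourier z (x p.1 - x p.2)).re := by
  have h1 : ‖∑ i, if σ i = a then UnitAddTorus.mFourier z (x i) else 0‖ ^ 2 =
      ∑ p : Fin n × Fin n, (if σ p.1 = a ∧ σ p.2 = a then (1 : ℝ) else 0) *
          (UnitAddTorus.mFourier z (x p.1 - x p.2)).re := by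
    have h2 : ∀ w : ℂ, ‖w‖ ^ 2 = (w * (starRingEnd ℂ) w).re := fun w => by
      rw [Complex.mul_conj, Complex.ofReal_re, Complex.normSq_eq_norm_sq]
    rw [h2, map_sum, Finset.sum_mul_sum, Fintype.sum_prod_type, Complex.re_sum]
    refine Finset.sum_congr rfl fun i _ => ?_
    rw [Complex.re_sum]
    refine Finset.sum_congr rfl fun j _ => ?_
    rw [mFourier_sub_apply]
    by_cases hi : σ i = a <;> by_cases hj : σ j = a <;> simp [hi, hj]
  rw [h1, ← Finset.univ_product_univ, ← Finset.diag_union_offDiag,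
    Finset.sum_union (Finset.disjoint_diag_offDiag _)]
  gcongr
  refine (Finset.sum_le_card_nsmul _ _ 1 fun p _ => ?_).trans (by simp [Finset.diag_card])
  have := (Complex.re_le_norm (UnitAddTorus.mFourier z (x p.1 - x p.2))).trans_eq
    (norm_mFourier_apply _ _)
  split_ifs <;> linarith

theorem tendsto_sum_mFourier (hk : 0 < k) (z : Fin d → ℤ) (a : Fin k)
    {σ : ∀ N : ℕ, Fin (k * N) → Fin k} (x : ∀ N : ℕ, Fin (k * N) → UnitAddTorus (Fin d))
    (h : Tendsto (fun N : ℕ => (∑ p ∈ (Finset.univ : Finset (Fin (k * N))).offDiag,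
      (if σ N p.1 = a ∧ σ N p.2 = a then (1 : ℝ) else 0) *
        (UnitAddTorus.mFourier z (x N p.1 - x N p.2)).re) / ((k * N : ℕ) : ℝ) ^ 2)
      atTop (𝓝 0)) :
    Tendsto (fun N : ℕ =>
      ((k * N : ℕ) : ℂ)⁻¹ * ∑ i, if σ N i = a then UnitAddTorus.mFourier z (x N i) else 0)
      atTop (𝓝 0) := by
  have hinv : Tendsto (fun N : ℕ => ((k * N : ℕ) : ℝ)⁻¹) atTop (𝓝 0) :=
    tendsto_inv_atTop_zero.comp (tendsto_natCast_atTop_atTop.comp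
      (tendsto_id.const_mul_atTop' hk))
  have hbound := hinv.add h
  rw [add_zero] at hbound
  have hsq : Tendsto (fun N : ℕ => ‖((k * N : ℕ) : ℂ)⁻¹ *
      ∑ i, if σ N i = a then UnitAddTorus.mFourier z (x N i) else 0‖ ^ 2) atTop (𝓝 0) := by
    refine squeeze_zero' (Eventually.of_forall fun N => sq_nonneg _) ?_ hbound
    filter_upwards [eventually_gt_atTop 0] with N hN
    have hn : (0 : ℝ) < ((k * N : ℕ) : ℝ) := by exact_mod_cast Nat.mul_pos hk hN
    rw [norm_mul, mul_pow, norm_inv, Complex.norm_natCast]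
    refine (mul_le_mul_of_nonneg_left (norm_sq_sum_mFourier_le z (σ N) a (x N))
      (by positivity)).trans (le_of_eq ?_)
    field_simp
  have := hsq.sqrt
  simp only [Real.sqrt_sq (norm_nonneg _), Real.sqrt_zero] at this
  exact tendsto_zero_iff_norm_tendsto_zero.2 this

end Equidistribution

/-! ### Support and moments of the limit measure -/

section LimitMoments

variable {d k : ℕ} {F F' : UnitAddTorus (Fin d) → ℝ}

/-- The contribution of the frequency `z` to the `m`-th moment of the limit measure. -/
def momentTerm (k : ℕ) (F F' : UnitAddTorus (Fin d) → ℝ) (m : ℕ) (z : Fin d → ℤ) : ℝ :=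
  (((fourierCoef F z).re + ((k : ℝ) - 1) * (fourierCoef F' z).re) / k) ^ m +
    ((k : ℝ) - 1) * (((fourierCoef F z).re - (fourierCoef F' z).re) / k) ^ m

/-- The first atom is a convex combination of `a` and `b`, with weights `1 / k` and `(k - 1) / k`.
-/
theorem abs_atom_le {k : ℕ} (hk : 1 ≤ k) (a b : ℝ) :
    |(a + ((k : ℝ) - 1) * b) / k| ≤ max |a| |b| ∧ |(a - b) / k| ≤ |a| + |b| := by
  have hk' : (1 : ℝ) ≤ k := by exact_mod_cast hk
  have hk0 : (0 : ℝ) < k := by linarith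
  constructor
  · rw [abs_div, abs_of_pos hk0, div_le_iff₀ hk0]
    calc |a + ((k : ℝ) - 1) * b| ≤ |a| + ((k : ℝ) - 1) * |b| := by
          refine (abs_add_le _ _).trans ?_
          rw [abs_mul, abs_of_nonneg (by linarith : (0 : ℝ) ≤ k - 1)]
      _ ≤ max |a| |b| + ((k : ℝ) - 1) * max |a| |b| :=
          add_le_add (le_max_left _ _)
            (mul_le_mul_of_nonneg_left (le_max_right _ _) (by linarith))
      _ = max |a| |b| * k := by ring
  · rw [abs_div, abs_of_pos hk0, div_le_iff₀ hk0]
    exact (abs_sub _ _).trans (le_mul_of_one_le_right (by positivity) hk')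

theorem abs_re_fourierCoef_le (hF : ∀ x, F x ∈ Set.Icc (0 : ℝ) 1) (z : Fin d → ℤ) :
    |(fourierCoef F z).re| ≤ 1 :=
  (Complex.abs_re_le_norm _).trans (norm_fourierCoef_le hF z)

theorem atoms_mem_Icc (hk : 2 ≤ k) (hF : ∀ x, F x ∈ Set.Icc (0 : ℝ) 1)
    (hF' : ∀ x, F' x ∈ Set.Icc (0 : ℝ) 1) (z : Fin d → ℤ) :
    ((fourierCoef F z).re + ((k : ℝ) - 1) * (fourierCoef F' z).re) / k ∈ Set.Icc (-1 : ℝ) 1 ∧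
    ((fourierCoef F z).re - (fourierCoef F' z).re) / k ∈ Set.Icc (-1 : ℝ) 1 := by
  have ha := abs_re_fourierCoef_le hF z
  have hb := abs_re_fourierCoef_le hF' z
  have hk' : (2 : ℝ) ≤ k := by exact_mod_cast hk
  refine ⟨abs_le.1 ((abs_atom_le (by omega) _ _).1.trans (max_le ha hb)), abs_le.1 ?_⟩
  -- The difference of two coefficients is at most 2 in modulus, which `k ≥ 2` absorbs.
  rw [abs_div, abs_of_pos (by linarith : (0 : ℝ) < k), div_le_iff₀ (by linarith)]
  exact (abs_sub _ _).trans (by linarith)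

/-- The atoms lie in `[-1, 1]`, so their squares dominate higher powers, and Parseval sums the
squares. In the majorant, `k` counts the atoms per frequency and 2 comes from `(p + q) ^ 2 ≤ 2 * (p
^ 2 + q ^ 2)`. -/
theorem summable_pow_atoms (hk : 2 ≤ k) (hFm : Measurable F) (hFm' : Measurable F')
    (hF : ∀ x, F x ∈ Set.Icc (0 : ℝ) 1) (hF' : ∀ x, F' x ∈ Set.Icc (0 : ℝ) 1) (m : ℕ) :
    Summable fun z => |((fourierCoef F z).re + ((k : ℝ) - 1) * (fourierCoef F' z).re) / k| ^ (m + 2)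
      + ((k : ℝ) - 1) * |((fourierCoef F z).re - (fourierCoef F' z).re) / k| ^ (m + 2) := by
  have hk' : (2 : ℝ) ≤ k := by exact_mod_cast hk
  have hs := (((summable_sq_fourierCoef hFm hF).add
    (summable_sq_fourierCoef hFm' hF')).mul_left 2).mul_left (k : ℝ)
  refine Summable.of_nonneg_of_le (fun z => ?_) (fun z => ?_) hs
  · have : (0 : ℝ) ≤ k - 1 := by linarith
    positivity
  · obtain ⟨hu, hv⟩ := atoms_mem_Icc hk hF hF' z
    set a := (fourierCoef F z).re
    set b := (fourierCoef F' z).re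
    have ha : |a| ≤ ‖fourierCoef F z‖ := Complex.abs_re_le_norm _
    have hb : |b| ≤ ‖fourierCoef F' z‖ := Complex.abs_re_le_norm _
    have hpow : ∀ t : ℝ, t ∈ Set.Icc (-1 : ℝ) 1 →
        |t| ≤ ‖fourierCoef F z‖ + ‖fourierCoef F' z‖ →
        |t| ^ (m + 2) ≤ 2 * (‖fourierCoef F z‖ ^ 2 + ‖fourierCoef F' z‖ ^ 2) := fun t ht hle => by
      calc |t| ^ (m + 2) ≤ |t| ^ 2 :=
            pow_le_pow_of_le_one (abs_nonneg _) (abs_le.2 ht) (by omega)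
        _ ≤ (‖fourierCoef F z‖ + ‖fourierCoef F' z‖) ^ 2 := by gcongr
        _ ≤ _ := by nlinarith [sq_nonneg (‖fourierCoef F z‖ - ‖fourierCoef F' z‖)]
    obtain ⟨h1, h2⟩ := abs_atom_le (by omega : 1 ≤ k) a b
    have h3 := hpow _ hu (h1.trans ((max_le_add_of_nonneg (abs_nonneg _) (abs_nonneg _)).trans
      (add_le_add ha hb)))
    have h4 := hpow _ hv (h2.trans (add_le_add ha hb))
    have h5 := mul_le_mul_of_nonneg_left h4 (by linarith : (0 : ℝ) ≤ k - 1)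
    linarith

theorem summable_momentTerm (hk : 2 ≤ k) (hFm : Measurable F) (hFm' : Measurable F')
    (hF : ∀ x, F x ∈ Set.Icc (0 : ℝ) 1) (hF' : ∀ x, F' x ∈ Set.Icc (0 : ℝ) 1) (m : ℕ) :
    Summable (momentTerm k F F' (m + 2)) := by
  have hk' : (2 : ℝ) ≤ k := by exact_mod_cast hk
  refine Summable.of_norm_bounded (summable_pow_atoms hk hFm hFm' hF hF' m) fun z => ?_
  refine (norm_add_le _ _).trans (le_of_eq ?_)
  rw [norm_mul, norm_pow, norm_pow, Real.norm_of_nonneg (by linarith : (0 : ℝ) ≤ k - 1)]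
  rfl

theorem integral_limitMeasure_summand (hk : 2 ≤ k) (f : ℝ → ℝ) (a b : ℝ) :
    ∫ x, f x ∂(Measure.dirac a + ((k - 1 : ℕ) : ℝ≥0∞) • Measure.dirac b) =
      f a + ((k : ℝ) - 1) * f b := by
  rw [integral_add_measure (integrable_dirac (by simp))
    ((integrable_dirac (by simp)).smul_measure (by simp)), integral_smul_measure,
    integral_dirac, integral_dirac, ENNReal.toReal_natCast, smul_eq_mul,
    Nat.cast_sub (by omega), Nat.cast_one]

theorem ae_limitMeasure_mem_Icc (hk : 2 ≤ k) (hF : ∀ x, F x ∈ Set.Icc (0 : ℝ) 1)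
    (hF' : ∀ x, F' x ∈ Set.Icc (0 : ℝ) 1) :
    ∀ᵐ x ∂(limitMeasure k F F'), x ∈ Set.Icc (-1 : ℝ) 1 := by
  refine Measure.ae_sum_iff.2 fun z => ?_
  obtain ⟨h1, h2⟩ := atoms_mem_Icc hk hF hF' z
  rw [ae_add_measure_iff]
  exact ⟨(ae_dirac_iff measurableSet_Icc).2 h1,
    Measure.ae_smul_measure ((ae_dirac_iff measurableSet_Icc).2 h2) _⟩

theorem integrable_pow_limitMeasure (hk : 2 ≤ k) (hFm : Measurable F) (hFm' : Measurable F')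
    (hF : ∀ x, F x ∈ Set.Icc (0 : ℝ) 1) (hF' : ∀ x, F' x ∈ Set.Icc (0 : ℝ) 1) (m : ℕ) :
    Integrable (fun x : ℝ => x ^ (m + 2)) (limitMeasure k F F') := by
  refine integrable_sum_measure (fun z => ?_) ?_
  · exact (integrable_dirac (by simp)).add_measure
      ((integrable_dirac (by simp)).smul_measure (by simp))
  · simp_rw [integral_limitMeasure_summand hk, norm_pow, Real.norm_eq_abs]
    exact summable_pow_atoms hk hFm hFm' hF hF' m

theorem integral_pow_limitMeasure (hk : 2 ≤ k) (hFm : Measurable F) (hFm' : Measurable F')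
    (hF : ∀ x, F x ∈ Set.Icc (0 : ℝ) 1) (hF' : ∀ x, F' x ∈ Set.Icc (0 : ℝ) 1) (m : ℕ) :
    ∫ x, x ^ (m + 2) ∂(limitMeasure k F F') = ∑' z, momentTerm k F F' (m + 2) z := by
  have h := (hasSum_integral_measure
    (integrable_pow_limitMeasure hk hFm hFm' hF hF' m)).tsum_eq
  rw [limitMeasure, ← h]
  simp_rw [integral_limitMeasure_summand hk]
  rfl

end LimitMoments

/-! ### Support and moments of the empirical spectral measure -/

section SpectralMoments

variable {n : ℕ}

open scoped Classical in
theorem abs_smul_adjMatrix_apply_le (H : SimpleGraph (Fin n)) (i j : Fin n) :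
    |((n : ℝ)⁻¹ • H.adjMatrix ℝ) i j| ≤ (n : ℝ)⁻¹ := by
  rw [Matrix.smul_apply, SimpleGraph.adjMatrix_apply, smul_eq_mul, abs_mul,
    abs_of_nonneg (by positivity : (0 : ℝ) ≤ (n : ℝ)⁻¹)]
  refine mul_le_of_le_one_right (by positivity) ?_
  split_ifs <;> simp

open scoped Classical in
theorem trace_smul_adjMatrix_pow (H : SimpleGraph (Fin n)) (m : ℕ) :
    (((n : ℝ)⁻¹ • H.adjMatrix ℝ) ^ m).trace =
      ∑ j, ((H.isHermitian_adjMatrix ℝ).eigenvalues j / n) ^ m := by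
  rw [smul_pow, Matrix.trace_smul, trace_pow_eq_sum_eigenvalues (H.isHermitian_adjMatrix ℝ),
    smul_eq_mul, Finset.mul_sum]
  refine Finset.sum_congr rfl fun j _ => ?_
  rw [div_pow, inv_pow]; ring

open scoped Classical in
theorem integral_spectralMeasure (H : SimpleGraph (Fin n)) (f : ℝ → ℝ) :
    ∫ x, f x ∂(spectralMeasure H) = ∑ j, f ((H.isHermitian_adjMatrix ℝ).eigenvalues j / n) := by
  rw [spectralMeasure, integral_finsetSum_measure fun j _ => integrable_dirac (by simp)]
  simp

theorem integrable_spectralMeasure (H : SimpleGraph (Fin n)) (f : ℝ → ℝ) :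
    Integrable f (spectralMeasure H) := by
  rw [spectralMeasure, integrable_finsetSum_measure]
  exact fun j _ => integrable_dirac (by simp)

-- The fourth powers of the normalized eigenvalues sum to the trace of a matrix with entries at most
-- `n⁻¹`, hence to at most 1.
open scoped Classical in
theorem abs_eigenvalue_div_le (H : SimpleGraph (Fin n)) (j : Fin n) :
    |(H.isHermitian_adjMatrix ℝ).eigenvalues j / n| ≤ 1 := by
  have hn : (0 : ℝ) < n := by exact_mod_cast j.pos
  have h1 : ((H.isHermitian_adjMatrix ℝ).eigenvalues j / n) ^ 4 ≤ 1 := by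
    calc ((H.isHermitian_adjMatrix ℝ).eigenvalues j / n) ^ 4
        ≤ ∑ j, ((H.isHermitian_adjMatrix ℝ).eigenvalues j / n) ^ 4 :=
          Finset.single_le_sum (f := fun j => ((H.isHermitian_adjMatrix ℝ).eigenvalues j / n) ^ 4)
            (fun i _ => by positivity) (Finset.mem_univ j)
      _ = (((n : ℝ)⁻¹ • H.adjMatrix ℝ) ^ 4).trace := (trace_smul_adjMatrix_pow H 4).symm
      _ ≤ ∑ _i : Fin n, (n : ℝ)⁻¹ := by
          refine Finset.sum_le_sum fun i _ => (le_abs_self _).trans ?_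
          have := abs_pow_mul_pow_apply_le (abs_smul_adjMatrix_apply_le H)
            (abs_smul_adjMatrix_apply_le H) 4 0 (by norm_num) i i
          simpa using this
      _ = 1 := by simp [hn.ne']
  rw [← (by decide : Even 4).pow_abs] at h1
  exact (pow_le_one_iff_of_nonneg (abs_nonneg _) (by norm_num)).1 h1

theorem ae_spectralMeasure_mem_Icc (H : SimpleGraph (Fin n)) :
    ∀ᵐ x ∂(spectralMeasure H), x ∈ Set.Icc (-1 : ℝ) 1 := by
  classical
  rw [spectralMeasure, ← Measure.sum_fintype]
  exact Measure.ae_sum_iff.2 fun j =>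
    (ae_dirac_iff measurableSet_Icc).2 (abs_le.1 (abs_eigenvalue_div_le H j))

end SpectralMoments

/-! ### Limit of the traces for a fixed realization -/

section TraceLimit

variable {d k : ℕ} {F F' : UnitAddTorus (Fin d) → ℝ}

open scoped Classical in
/-- The traces of powers of the normalized adjacency matrices of graphs that are close to
the connection probabilities at equidistributed positions. -/
theorem tendsto_trace_adjMatrix_pow (hk : 2 ≤ k) (hFm : Measurable F) (hFm' : Measurable F')
    (hF : ∀ x, F x ∈ Set.Icc (0 : ℝ) 1) (hF' : ∀ x, F' x ∈ Set.Icc (0 : ℝ) 1)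
    (hFe : ∀ x, F (-x) = F x) (hFe' : ∀ x, F' (-x) = F' x)
    {σ : ∀ N : ℕ, Fin (k * N) → Fin k}
    (hσ : ∀ (N : ℕ) (q : Fin k), (Finset.univ.filter fun i => σ N i = q).card = N)
    (x : ∀ N : ℕ, Fin (k * N) → UnitAddTorus (Fin d)) (H : ∀ N : ℕ, SimpleGraph (Fin (k * N)))
    (hbil : ∀ δ : ℝ, 0 < δ → ∀ᶠ N : ℕ in atTop,
      BilinLE ((H N).adjMatrix ℝ - connMatrix (blockFun F F') (σ N) (x N))
        (δ * ((k * N : ℕ) : ℝ) ^ 2))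
    (hx : ∀ z : Fin d → ℤ, z ≠ 0 → ∀ a : Fin k, Tendsto (fun N : ℕ =>
      ((k * N : ℕ) : ℂ)⁻¹ * ∑ i, if σ N i = a then UnitAddTorus.mFourier z (x N i) else 0)
      atTop (𝓝 0))
    (hR : ∀ S : Finset (Fin d → ℤ), Tendsto (fun N : ℕ =>
      (∑ p ∈ (Finset.univ : Finset (Fin (k * N))).offDiag,
      (if σ N p.1 = σ N p.2 then (1 : ℝ) else 0) * centredSqError F S (x N p.1 - x N p.2)) /
        ((k * N : ℕ) : ℝ) ^ 2) atTop (𝓝 0))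
    (hR' : ∀ S : Finset (Fin d → ℤ), Tendsto (fun N : ℕ =>
      (∑ p ∈ (Finset.univ : Finset (Fin (k * N))).offDiag,
      (if σ N p.1 = σ N p.2 then (0 : ℝ) else 1) * centredSqError F' S (x N p.1 - x N p.2)) /
        ((k * N : ℕ) : ℝ) ^ 2) atTop (𝓝 0)) (m : ℕ) :
    Tendsto (fun N : ℕ => ((((k * N : ℕ) : ℝ)⁻¹ • (H N).adjMatrix ℝ) ^ (m + 3)).trace) atTop
      (𝓝 (∑' z, momentTerm k F F' (m + 3) z)) := by
  have hk0 : 0 < k := by omega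
  let A : ∀ N : ℕ, Matrix (Fin (k * N)) (Fin (k * N)) ℝ := fun N =>
    ((k * N : ℕ) : ℝ)⁻¹ • (H N).adjMatrix ℝ
  let M : ∀ N : ℕ, Matrix (Fin (k * N)) (Fin (k * N)) ℝ := fun N =>
    ((k * N : ℕ) : ℝ)⁻¹ • connMatrix (blockFun F F') (σ N) (x N)
  have hA : ∀ N i j, |A N i j| ≤ ((k * N : ℕ) : ℝ)⁻¹ := fun N =>
    abs_smul_adjMatrix_apply_le (H N)
  have hM : ∀ N i j, |M N i j| ≤ ((k * N : ℕ) : ℝ)⁻¹ := fun N i j => by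
    simp only [M, Matrix.smul_apply, connMatrix, Matrix.of_apply, smul_eq_mul, blockFun]
    rw [abs_mul, abs_of_nonneg (by positivity : (0 : ℝ) ≤ ((k * N : ℕ) : ℝ)⁻¹)]
    refine mul_le_of_le_one_right (by positivity) ?_
    split_ifs
    · simp
    · rw [abs_of_nonneg (hF _).1]; exact (hF _).2
    · rw [abs_of_nonneg (hF' _).1]; exact (hF' _).2
  have hMsq : ∀ N, ∑ i, ∑ j, ‖((M N).map ((↑) : ℝ → ℂ)) i j‖ ^ 2 ≤ 1 := fun N => by
    rcases Nat.eq_zero_or_pos N with rfl | hN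
    · simp
    have hn : (0 : ℝ) < ((k * N : ℕ) : ℝ) := by exact_mod_cast Nat.mul_pos hk0 hN
    calc ∑ i, ∑ j, ‖((M N).map ((↑) : ℝ → ℂ)) i j‖ ^ 2
        ≤ ∑ _i : Fin (k * N), ∑ _j : Fin (k * N), (((k * N : ℕ) : ℝ)⁻¹) ^ 2 := by
          refine Finset.sum_le_sum fun i _ => Finset.sum_le_sum fun j _ => ?_
          rw [Matrix.map_apply, Complex.norm_real]
          exact pow_le_pow_left₀ (norm_nonneg _) (hM N i j) 2
      _ = 1 := by
          simp only [Finset.sum_const, Finset.card_univ, Fintype.card_fin, nsmul_eq_mul]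
          field_simp
  have hsum : Tendsto (fun S : Finset (Fin d → ℤ) => ∑ z ∈ S, momentTerm k F F' (m + 3) z) atTop
      (𝓝 (∑' z, momentTerm k F F' (m + 3) z)) :=
    (summable_momentTerm hk hFm hFm' hF hF' (m + 1)).hasSum
  rw [Metric.tendsto_atTop']
  intro ε hε
  obtain ⟨η, hη0, hη1, hηε⟩ : ∃ η : ℝ, 0 < η ∧ η ≤ 1 ∧
      ((m + 1 : ℕ) + 2 : ℝ) * 2 ^ (m + 1 + 1) * η ≤ ε / 4 := by
    refine ⟨min 1 (ε / 4 / (((m + 1 : ℕ) + 2 : ℝ) * 2 ^ (m + 1 + 1))), by positivity,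
      min_le_left _ _, ?_⟩
    rw [mul_comm, ← le_div_iff₀ (by positivity)]
    exact min_le_right _ _
  have herr : Tendsto (fun S : Finset (Fin d → ℤ) => meanSqError F S + meanSqError F' S) atTop
      (𝓝 0) := by
    simpa [meanSqError] using (tendsto_integral_sq_sub_trigPoly hFm hF).add
      (tendsto_integral_sq_sub_trigPoly hFm' hF')
  -- One finite set of frequencies makes both the mean-square error and the tail of the limiting
  -- moment small; it is fixed before `N` grows.
  obtain ⟨S, hS1, hS2⟩ := ((herr.eventually_lt_const (by positivity : (0 : ℝ) < η ^ 2)).and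
    (Metric.tendsto_nhds.1 hsum (ε / 4) (by positivity))).exists
  have hL := tendsto_trace_trigMatrix_pow hk0 S (fourierCoef F) (fourierCoef F') hσ x hx (m + 2)
  have hLval : ∑ z ∈ S, (((fourierCoef F z + (k - 1) * fourierCoef F' z) / k) ^ (m + 2 + 1)
        + ((k : ℂ) - 1) * ((fourierCoef F z - fourierCoef F' z) / k) ^ (m + 2 + 1)) =
      ((∑ z ∈ S, momentTerm k F F' (m + 3) z : ℝ) : ℂ) := by
    rw [Complex.ofReal_sum]
    refine Finset.sum_congr rfl fun z _ => ?_
    -- Evenness makes the coefficients real, so the complex trace limit is the real partial moment.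
    have h1 : fourierCoef F z = ((fourierCoef F z).re : ℂ) :=
      Complex.ext rfl (by simpa using fourierCoef_im hFe z)
    have h2 : fourierCoef F' z = ((fourierCoef F' z).re : ℂ) :=
      Complex.ext rfl (by simpa using fourierCoef_im hFe' z)
    rw [h1, h2, momentTerm]
    push_cast
    rfl
  rw [hLval] at hL
  have e1 := hbil (ε / 4 / (m + 3 : ℕ)) (by positivity)
  have e2 := eventually_sum_norm_sq_le hk0 S x (hR S) (hR' S) hS1
  have e3 := Metric.tendsto_nhds.1 hL (ε / 4) (by positivity)
  obtain ⟨N0, hN0⟩ := eventually_atTop.1 (e1.and (e2.and (e3.and (eventually_gt_atTop 0))))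
  refine ⟨N0, fun N hN => ?_⟩
  obtain ⟨c1, c2, c3, hNpos⟩ := hN0 N hN.le
  have hn : 0 < k * N := Nat.mul_pos hk0 hNpos
  have hn' : (0 : ℝ) < ((k * N : ℕ) : ℝ) := by exact_mod_cast hn
  have hD : BilinLE (A N - M N) (ε / 4 / (m + 3 : ℕ) * ((k * N : ℕ) : ℝ)) := fun u v => by
    have h := mul_le_mul_of_nonneg_left (c1 u v) (inv_pos.2 hn').le
    refine le_trans (le_of_eq ?_) (h.trans (le_of_eq ?_))
    · rw [Finset.mul_sum]
      refine Finset.sum_congr rfl fun i _ => ?_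
      rw [Finset.mul_sum]
      refine Finset.sum_congr rfl fun j _ => ?_
      simp only [A, M, Matrix.sub_apply, Matrix.smul_apply, smul_eq_mul]
      ring
    · field_simp
  have b1 := hD.abs_trace_pow_sub_le (hA N) (hM N) hn (m := m + 3) (by omega)
  have b1' : |(A N ^ (m + 3)).trace - (M N ^ (m + 3)).trace| ≤ ε / 4 := by
    refine b1.trans (le_of_eq ?_)
    have : (((m + 3 : ℕ) : ℝ)) ≠ 0 := by positivity
    field_simp
  have b2 := (norm_trace_pow_sub_le hη0.le hη1 (hMsq N) c2 (m + 1)).trans hηε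
  have hMtr : (((M N).map ((↑) : ℝ → ℂ)) ^ (m + 3)).trace = (((M N ^ (m + 3)).trace : ℝ) : ℂ) := by
    have h1 : ((M N).map ((↑) : ℝ → ℂ)) ^ (m + 3) = (M N ^ (m + 3)).map ((↑) : ℝ → ℂ) :=
      (map_pow (Complex.ofRealHom.mapMatrix) (M N) (m + 3)).symm
    rw [h1]
    simp [Matrix.trace]
  have b3 : |(M N ^ (m + 3)).trace - ∑ z ∈ S, momentTerm k F F' (m + 3) z| < ε / 4 + ε / 4 := by
    rw [← Real.norm_eq_abs, ← Complex.norm_real, Complex.ofReal_sub, ← hMtr]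
    rw [dist_eq_norm] at c3
    refine (norm_sub_le_norm_sub_add_norm_sub _ _ _).trans_lt (add_lt_add_of_le_of_lt b2 c3)
  rw [Real.dist_eq] at hS2 ⊢
  change |(A N ^ (m + 3)).trace - _| < ε
  rw [abs_le] at b1'
  rw [abs_lt] at b3 hS2 ⊢
  -- Four errors of `ε / 4`: cut norm, Hilbert-Schmidt norm, convergence for the fixed `S`, and the
  -- tail of the frequency sum.
  constructor <;> linarith [b1'.1, b1'.2, b3.1, b3.2, hS2.1, hS2.2]

end TraceLimit

/-! ### Hypotheses of the law of large numbers -/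

section AlmostSure

variable {d : ℕ}

theorem IsSGBM.map_position {Ω : Type*} [MeasurableSpace Ω] {P : Measure Ω}
    [IsProbabilityMeasure P] {k n : ℕ} {F : UnitAddTorus (Fin d) → Fin k → Fin k → ℝ}
    {σ : Fin n → Fin k} {X : Fin n → Ω → UnitAddTorus (Fin d)} {G : Ω → SimpleGraph (Fin n)}
    (hG : IsSGBM P F σ X G) :
    P.map (fun ω i => X i ω) = Measure.pi fun _ => torusMeasure d := by
  rw [(iIndepFun_iff_map_fun_eq_pi_map
    fun i => (hG.measurable_position i).aemeasurable).1 hG.indep_position]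
  simp_rw [hG.uniform_position]

variable {F : UnitAddTorus (Fin d) → ℝ}

theorem measurable_sq_error (hFm : Measurable F) (S : Finset (Fin d → ℤ)) :
    Measurable fun x => ‖(F x : ℂ) - trigPoly S (fourierCoef F) x‖ ^ 2 :=
  ((Complex.measurable_ofReal.comp hFm).sub
    (continuous_trigPoly S _).measurable).norm.pow_const 2

theorem sq_error_le (hF : ∀ x, F x ∈ Set.Icc (0 : ℝ) 1) (S : Finset (Fin d → ℤ))
    (x : UnitAddTorus (Fin d)) : ‖(F x : ℂ) - trigPoly S (fourierCoef F) x‖ ^ 2 ≤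
      (1 + ∑ z ∈ S, ‖fourierCoef F z‖) ^ 2 := by
  refine pow_le_pow_left₀ (norm_nonneg _) ((norm_sub_le _ _).trans
    (add_le_add ?_ (norm_trigPoly_le _ _ _))) 2
  rw [Complex.norm_real, Real.norm_of_nonneg (hF x).1]
  exact (hF x).2

theorem measurable_centredSqError (hFm : Measurable F) (S : Finset (Fin d → ℤ)) :
    Measurable (centredSqError F S) := (measurable_sq_error hFm S).sub_const _

theorem abs_centredSqError_le (hF : ∀ x, F x ∈ Set.Icc (0 : ℝ) 1) (S : Finset (Fin d → ℤ))
    (x : UnitAddTorus (Fin d)) : |centredSqError F S x| ≤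
      (1 + ∑ z ∈ S, ‖fourierCoef F z‖) ^ 2 + meanSqError F S := by
  have h1 := sq_error_le hF S x
  have h2 := meanSqError_nonneg (F := F) S
  have h3 := sq_nonneg ‖(F x : ℂ) - trigPoly S (fourierCoef F) x‖
  rw [centredSqError, abs_le]
  constructor
  · nlinarith [sq_nonneg (1 + ∑ z ∈ S, ‖fourierCoef F z‖)]
  · linarith

theorem integral_centredSqError (hFm : Measurable F) (hF : ∀ x, F x ∈ Set.Icc (0 : ℝ) 1)
    (S : Finset (Fin d → ℤ)) : ∫ x, centredSqError F S x ∂(torusMeasure d) = 0 := by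
  have hi : Integrable (fun x => ‖(F x : ℂ) - trigPoly S (fourierCoef F) x‖ ^ 2)
      (torusMeasure d) :=
    Integrable.of_bound (measurable_sq_error hFm S).aestronglyMeasurable _
      (Eventually.of_forall fun x => by
        rw [Real.norm_of_nonneg (sq_nonneg _)]; exact sq_error_le hF S x)
  unfold centredSqError
  rw [integral_sub hi (integrable_const _)]
  simp [meanSqError]

theorem integral_re_mFourier {z : Fin d → ℤ} (hz : z ≠ 0) :
    ∫ x, (UnitAddTorus.mFourier z x).re ∂(torusMeasure d) = 0 := by
  have hi : Integrable (fun x => UnitAddTorus.mFourier z x) (torusMeasure d) :=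
    Integrable.of_bound (UnitAddTorus.mFourier z).continuous.aestronglyMeasurable 1
      (Eventually.of_forall fun x => (norm_mFourier_apply z x).le)
  have := integral_re hi
  rw [integral_mFourier hz] at this
  simpa using this

end AlmostSure

end SGBM

end

/-! ### Conclusion on a common almost sure event -/

theorem mainTheorem3 {d k : ℕ} (hk : 2 ≤ k)
    (Fᵢₙ Fₒᵤₜ : UnitAddTorus (Fin d) → ℝ)
    (hFᵢₙ : Measurable Fᵢₙ) (hFₒᵤₜ : Measurable Fₒᵤₜ)
    (hFᵢₙ01 : ∀ x, Fᵢₙ x ∈ Set.Icc (0 : ℝ) 1) (hFₒᵤₜ01 : ∀ x, Fₒᵤₜ x ∈ Set.Icc (0 : ℝ) 1)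
    (hFᵢₙeven : ∀ x, Fᵢₙ (-x) = Fᵢₙ x) (hFₒᵤₜeven : ∀ x, Fₒᵤₜ (-x) = Fₒᵤₜ x)
    (S : ℕ → Finset (Fin d → ℤ)) (hS : Tendsto S atTop atTop)
    (hFᵢₙ0 : SGBM.EqFourierSeriesAtZero S Fᵢₙ)
    (hFₒᵤₜ0 : SGBM.EqFourierSeriesAtZero S Fₒᵤₜ)
    (σ : ∀ N : ℕ, Fin (k * N) → Fin k)
    (hσ : ∀ (N : ℕ) (q : Fin k), (Finset.univ.filter fun i => σ N i = q).card = N)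
    {Ω : Type*} [MeasurableSpace Ω] (P : Measure Ω) [IsProbabilityMeasure P]
    (X : ∀ N : ℕ, Fin (k * N) → Ω → UnitAddTorus (Fin d))
    (G : ∀ N : ℕ, Ω → SimpleGraph (Fin (k * N)))
    (hG : ∀ N, SGBM.IsSGBM P (SGBM.blockFun Fᵢₙ Fₒᵤₜ) (σ N) (X N) (G N)) :
    ∀ᵐ ω ∂P, ∀ B : Set ℝ, MeasurableSet B →
      SGBM.limitMeasure k Fᵢₙ Fₒᵤₜ (frontier B) = 0 → (0 : ℝ) ∉ closure B →
        Tendsto (fun N : ℕ => SGBM.spectralMeasure (G N ω) B) atTop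
          (𝓝 (SGBM.limitMeasure k Fᵢₙ Fₒᵤₜ B)) := by
  have hk0 : 0 < k := by omega
  have hXm : ∀ N i, Measurable (X N i) := fun N => (hG N).measurable_position
  have hlaw : ∀ N, P.map (fun ω i => X N i ω) = Measure.pi fun _ => SGBM.torusMeasure d :=
    fun N => (hG N).map_position
  have hbil := SGBM.ae_eventually_bilinLE hk0 (F := SGBM.blockFun (k := k) Fᵢₙ Fₒᵤₜ)
    (fun x a b => by
      unfold SGBM.blockFun
      split_ifs
      · exact hFᵢₙ01 x
      · exact hFₒᵤₜ01 x)
    (fun a b => by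
      unfold SGBM.blockFun
      split_ifs
      · exact hFᵢₙ
      · exact hFₒᵤₜ)
    (fun x a b => by
      unfold SGBM.blockFun
      simp only [hFᵢₙeven, hFₒᵤₜeven, eq_comm])
    hG
  have hLLN : ∀ᵐ ω ∂P, ∀ z : Fin d → ℤ, z ≠ 0 → ∀ a : Fin k, Tendsto (fun N : ℕ =>
      ((k * N : ℕ) : ℂ)⁻¹ * ∑ i, if σ N i = a then UnitAddTorus.mFourier z (X N i ω) else 0)
      atTop (𝓝 0) := by
    -- Frequencies and communities are countably many, so one null set serves them all; finite sets
    -- of frequencies are treated alike below.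
    refine ae_all_iff.2 fun z => ?_
    by_cases hz : z = 0
    · exact Eventually.of_forall fun ω h => absurd hz h
    have := ae_all_iff.2 fun a : Fin k => SGBM.ae_tendsto_sum_diff (μ := SGBM.torusMeasure d)
      (h := fun x => (UnitAddTorus.mFourier z x).re) (C := 1) hk0 hXm hlaw
      (Complex.measurable_re.comp (UnitAddTorus.mFourier z).continuous.measurable)
      (fun x => (Complex.abs_re_le_norm _).trans (SGBM.norm_mFourier_apply z x).le)
      (SGBM.integral_re_mFourier hz)
      (fun N p => if σ N p.1 = a ∧ σ N p.2 = a then (1 : ℝ) else 0)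
      (fun N p => by split_ifs <;> simp)
    filter_upwards [this] with ω hω _ a
    exact SGBM.tendsto_sum_mFourier hk0 z a (fun N i => X N i ω) (hω a)
  have hR : ∀ᵐ ω ∂P, ∀ T : Finset (Fin d → ℤ), Tendsto (fun N : ℕ =>
      (∑ p ∈ (Finset.univ : Finset (Fin (k * N))).offDiag,
      (if σ N p.1 = σ N p.2 then (1 : ℝ) else 0) *
        SGBM.centredSqError Fᵢₙ T (X N p.1 ω - X N p.2 ω)) /
        ((k * N : ℕ) : ℝ) ^ 2) atTop (𝓝 0) :=
    ae_all_iff.2 fun T => SGBM.ae_tendsto_sum_diff (μ := SGBM.torusMeasure d) hk0 hXm hlaw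
      (SGBM.measurable_centredSqError hFᵢₙ T) (SGBM.abs_centredSqError_le hFᵢₙ01 T)
      (SGBM.integral_centredSqError hFᵢₙ hFᵢₙ01 T)
      (fun N p => if σ N p.1 = σ N p.2 then (1 : ℝ) else 0) (fun N p => by split_ifs <;> simp)
  have hR' : ∀ᵐ ω ∂P, ∀ T : Finset (Fin d → ℤ), Tendsto (fun N : ℕ =>
      (∑ p ∈ (Finset.univ : Finset (Fin (k * N))).offDiag,
      (if σ N p.1 = σ N p.2 then (0 : ℝ) else 1) *
        SGBM.centredSqError Fₒᵤₜ T (X N p.1 ω - X N p.2 ω)) /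
        ((k * N : ℕ) : ℝ) ^ 2) atTop (𝓝 0) :=
    ae_all_iff.2 fun T => SGBM.ae_tendsto_sum_diff (μ := SGBM.torusMeasure d) hk0 hXm hlaw
      (SGBM.measurable_centredSqError hFₒᵤₜ T) (SGBM.abs_centredSqError_le hFₒᵤₜ01 T)
      (SGBM.integral_centredSqError hFₒᵤₜ hFₒᵤₜ01 T)
      (fun N p => if σ N p.1 = σ N p.2 then (0 : ℝ) else 1) (fun N p => by split_ifs <;> simp)
  filter_upwards [hbil, hLLN, hR, hR'] with ω h1 h2 h3 h4 B hBm hB h0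
  refine SGBM.tendsto_measure_of_tendsto_moments
    (fun N => SGBM.ae_spectralMeasure_mem_Icc (G N ω))
    (SGBM.ae_limitMeasure_mem_Icc hk hFᵢₙ01 hFₒᵤₜ01)
    (fun N => SGBM.integrable_spectralMeasure (G N ω) _)
    (SGBM.integrable_pow_limitMeasure hk hFᵢₙ hFₒᵤₜ hFᵢₙ01 hFₒᵤₜ01 2) (fun m => ?_) hBm hB h0
  -- The exponent `m + 4` of the weighted moments is `(m + 1) + 3`; order 3 is available but
  -- unneeded, since the weight must be nonnegative.
  have hlim := SGBM.tendsto_trace_adjMatrix_pow hk hFᵢₙ hFₒᵤₜ hFᵢₙ01 hFₒᵤₜ01 hFᵢₙeven hFₒᵤₜeven hσ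
    (fun N i => X N i ω) (fun N => G N ω) h1 h2 h3 h4 (m + 1)
  simp_rw [← pow_add]
  rw [SGBM.integral_pow_limitMeasure hk hFᵢₙ hFₒᵤₜ hFᵢₙ01 hFₒᵤₜ01 (m + 2)]
  simp_rw [SGBM.integral_spectralMeasure]
  simp_rw [SGBM.trace_smul_adjMatrix_pow] at hlim
  exact hlim
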